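/- Let $T,L\ge 1$ be integers, $V=TL^3$, and consider a $T\times L^3$ lattice (spacing $1$; direction $\mu=0$ is time) with links $U(x,\mu)\in SU(3)$ and $z(x,\mu)\in U(1)$, $x\in\mathbb Z^4$, periodic with period $T$ in time and with C$^\star$ boundary conditions in space: $U(x+L\hat k,\mu)=U(x,\mu)^*$, $z(x+L\hat k,\mu)=z(x,\mu)^*$ for $k=1,2,3$. Let $\gamma_0,\dots,\gamma_3$ be hermitian $4\times4$ matrices with $\gamma_\mu\gamma_\nu+\gamma_\nu\gamma_\mu=2\delta_{\mu\nu}$ in a chiral basis ($\gamma_5=\gamma_0\gamma_1\gamma_2\gamma_3$ diagonal, $\gamma_{0},\gamma_2$ real, $\gamma_{1},\gamma_3$ imaginary), and put $C=i\gamma_0\gamma_2$ and $\sigma_{\mu\nu}=\frac i2[\gamma_\mu,\gamma_\nu]$. Let $K=\begin{pmatrix}0&1\\1&0\end{pmatrix}$ act on the quark-antiquark doublet. Let $\hat q\in\mathbb Z$ and $m,r,c_{3},c_{1}\in\mathbb R$. The Dirac operator is the $24V\times24V$ matrix acting on doublets $\chi$ with $\chi(x+T\hat 0)=\chi(x)$,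 $\chi(x+L\hat k)=K\chi(x)$ given by $$D=m+\frac12\sum_\mu\left\{\gamma_\mu(\nabla_\mu-\nabla_\mu^\dagger)+r\,\nabla_\mu^\dagger\nabla_\mu\right\}-\frac14\sum_{\mu,\nu}\sigma_{\mu\nu}\left\{c_{3}\begin{pmatrix}\hat G_{\mu\nu}&0\\0&-\hat G_{\mu\nu}^*\end{pmatrix}+\hat q\,c_{1}\begin{pmatrix}\hat F_{\mu\nu}&0\\0&-\hat F_{\mu\nu}^*\end{pmatrix}\right\},$$ $$\nabla_\mu\chi(x)=\begin{pmatrix}z^{\hat q}U(x,\mu)&0\\0&z^{-\hat q}U^*(x,\mu)\end{pmatrix}\chi(x+\hat\mu)-\chi(x),$$ where $\dagger$ is the adjoint on this $24V$-dimensional space and $\hat G_{\mu\nu}=\frac1{8i}(Q_{\mu\nu}-Q_{\nu\mu})$ is the clover discretization of the hermitian $SU(3)$ field tensor, with $Q_{\mu\nu}(x)$ the sum of the four plaquette loops of $U$ in the $(\mu,\nu)$ plane that start and end at $x$, all oriented as the loop that first goes along $\hat\mu$ and then along $\hat\nu$; $\hat F_{\mu\nu}$ is the same expression for the links $z$. The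 pfaffian of a $2n\times 2n$ antisymmetric matrix is $\mathrm{pf}\,A=\frac1{2^nn!}\sum_{\sigma}\mathrm{sgn}(\sigma)\prod_{i=1}^{n}A_{\sigma(2i-1)\sigma(2i)}$; here the basis is ordered lexicographically as a product of sites (in any order), colour, doublet and spin. Then $CKD$ is antisymmetric, all eigenvalues of $Q=\gamma_5D$ are real and of even degeneracy, and if $\lambda_1,\dots,\lambda_{12V}\in\mathbb R$ is the list of eigenvalues of $Q$, each appearing a number of times equal to half its degeneracy, then $$\mathrm{pf}(CKD)=\prod_{n=1}^{12V}\lambda_n .$$ In particular $\mathrm{pf}(CKD)$ is real and, if it is nonzero, its sign is $(-1)^{N}$, where $N$ is the number of indices $n$ with $\lambda_n<0$. -/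

import Mathlib

open scoped Kronecker

namespace CStar

noncomputable section

/-! ### Pfaffian -/

/-- The pfaffian of a `2n × 2n` (antisymmetric) complex matrix,
`pf A = (2^n n!)⁻¹ ∑_σ sgn σ ∏_i A (σ (2i)) (σ (2i+1))`. -/
def pfaffian {n : ℕ} (A : Matrix (Fin (2 * n)) (Fin (2 * n)) ℂ) : ℂ :=
  (1 / ((2 : ℂ) ^ n * (n.factorial : ℂ))) *
    ∑ σ : Equiv.Perm (Fin (2 * n)), ((Equiv.Perm.sign σ : ℤ) : ℂ) *
      ∏ i : Fin n, A (σ ⟨2 * i.1, by omega⟩) (σ ⟨2 * i.1 + 1, by omega⟩)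

/-! ### Gamma matrices -/

/-- Spin matrices. -/
abbrev SpinMatrix := Matrix (Fin 4) (Fin 4) ℂ

/-- `γ₅ = γ₀ γ₁ γ₂ γ₃`. -/
def gamma5 (γ : Fin 4 → SpinMatrix) : SpinMatrix := γ 0 * γ 1 * γ 2 * γ 3

/-- The charge conjugation matrix `C = i γ₀ γ₂`. -/
def chargeConj (γ : Fin 4 → SpinMatrix) : SpinMatrix := Complex.I • (γ 0 * γ 2)

/-- `σ_{μν} = (i/2) [γ_μ, γ_ν]`. -/
def sigma (γ : Fin 4 → SpinMatrix) (μ ν : Fin 4) : SpinMatrix :=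
  (Complex.I / 2) • (γ μ * γ ν - γ ν * γ μ)

/-- `γ` is a set of hermitian Euclidean gamma matrices in a chiral basis: `γ₅` is diagonal,
`γ₀, γ₂` are real and `γ₁, γ₃` are imaginary. -/
structure IsChiralBasis (γ : Fin 4 → SpinMatrix) : Prop where
  clifford : ∀ μ ν, γ μ * γ ν + γ ν * γ μ = if μ = ν then 2 else 0
  hermitian : ∀ μ, (γ μ).IsHermitian
  gamma5_diag : (gamma5 γ).IsDiag
  real_zero : ∀ s t, (γ 0 s t).im = 0
  real_two : ∀ s t, (γ 2 s t).im = 0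
  imag_one : ∀ s t, (γ 1 s t).re = 0
  imag_three : ∀ s t, (γ 3 s t).re = 0

/-! ### The lattice and the gauge fields -/

/-- Points of the infinite lattice `ℤ⁴`; direction `0` is time. -/
abbrev Point := Fin 4 → ℤ

/-- The unit vector in direction `μ`. -/
def unitVec (μ : Fin 4) : Point := Pi.single μ 1

/-- The number of lattice sites in direction `μ`: `T` in time, `L` in space. -/
def extent (T L : ℕ) (μ : Fin 4) : ℕ := if μ = 0 then T else L

/-- Sites of the finite `T × L³` lattice. -/
abbrev Site (T L : ℕ) := ∀ μ : Fin 4, Fin (extent T L μ)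

/-- The point of `ℤ⁴` that represents a site, with coordinates `0 ≤ x_μ < extent μ`. -/
def Site.toPoint {T L : ℕ} (x : Site T L) : Point := fun μ => ((x μ : ℕ) : ℤ)

/-- `SU(3)` and `U(1)` link variables on `ℤ⁴`, periodic in time and subject to C⋆ boundary
conditions (translation by `L` is complex conjugation) in the three spatial directions. -/
structure GaugeField (T L : ℕ) where
  /-- the `SU(3)` links `U(x, μ)` -/
  U : Point → Fin 4 → Matrix.specialUnitaryGroup (Fin 3) ℂ
  /-- the `U(1)` links `z(x, μ)` -/
  z : Point → Fin 4 → Circle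
  U_time : ∀ x μ, U (x + (T : ℤ) • unitVec 0) μ = U x μ
  z_time : ∀ x μ, z (x + (T : ℤ) • unitVec 0) μ = z x μ
  U_space : ∀ k : Fin 4, k ≠ 0 → ∀ x μ,
    (U (x + (L : ℤ) • unitVec k) μ : Matrix (Fin 3) (Fin 3) ℂ)
      = (U x μ : Matrix (Fin 3) (Fin 3) ℂ).map star
  z_space : ∀ k : Fin 4, k ≠ 0 → ∀ x μ,
    (z (x + (L : ℤ) • unitVec k) μ : ℂ) = star (z x μ : ℂ)

/-- The sum of the four plaquette loops ("clover leaves") in the `(μ, ν)` plane that start and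
end at `x`; `star` is the inverse of a unitary link. -/
def cloverSum {R : Type*} [Ring R] [Star R] (u : Point → Fin 4 → R) (μ ν : Fin 4) (x : Point) :
    R :=
  let a := unitVec μ
  let b := unitVec ν
  u x μ * u (x + a) ν * star (u (x + b) μ) * star (u x ν)
  + u x ν * star (u (x - a + b) μ) * star (u (x - a) ν) * u (x - a) μ
  + star (u (x - a) μ) * star (u (x - a - b) ν) * u (x - a - b) μ * u (x - b) ν
  + star (u (x - b) ν) * u (x - b) μ * u (x + a - b) ν * star (u x μ)

/-- The clover discretization `(1 / 8i) (Q_{μν}(x) - Q_{νμ}(x))` of the hermitian field tensor,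
where `Q` is the clover sum. -/
def fieldTensor {R : Type*} [Ring R] [Star R] [Algebra ℂ R] (u : Point → Fin 4 → R)
    (μ ν : Fin 4) (x : Point) : R :=
  (1 / (8 * Complex.I)) • (cloverSum u μ ν x - cloverSum u ν μ x)

/-! ### The Dirac operator on the quark-antiquark doublet

Colour-doublet indices are `Fin 3 × Fin 2`; in the doublet, `0` is the quark and `1` the
antiquark. -/

/-- Colour-doublet matrices. -/
abbrev CDMatrix := Matrix (Fin 3 × Fin 2) (Fin 3 × Fin 2) ℂ

/-- The matrix that exchanges quark and antiquark, on the colour-doublet space. -/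
def Kcd : CDMatrix := (1 : Matrix (Fin 3) (Fin 3) ℂ) ⊗ₖ !![0, 1; 1, 0]

/-- All indices but spin. -/
abbrev SCDIndex (T L : ℕ) := Site T L × (Fin 3 × Fin 2)

/-- The index set of the Dirac operator, with `24 T L³` elements. -/
abbrev Index (T L : ℕ) := SCDIndex T L × Fin 4

variable {T L : ℕ}

/-- The site reached from `x` by a step in direction `μ`, wrapped around the lattice. -/
def Site.shift (x : Site T L) (μ : Fin 4) : Site T L :=
  Function.update x μ (finRotate _ (x μ))

/-- `χ(x + μ̂)` is this matrix times `χ` at the wrapped site: it is `K` if the step crosses a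
spatial boundary, and the identity otherwise. -/
def Site.twist (x : Site T L) (μ : Fin 4) : CDMatrix :=
  if μ ≠ 0 ∧ (x μ : ℕ) + 1 = extent T L μ then Kcd else 1

namespace GaugeField

/-- The block matrix `diag (z^q U, z^{-q} U*)`. -/
def link (g : GaugeField T L) (q : ℤ) (x : Point) (μ : Fin 4) : CDMatrix :=
  Matrix.blockDiagonal
    ![((g.z x μ ^ q : Circle) : ℂ) • (g.U x μ : Matrix (Fin 3) (Fin 3) ℂ),
      ((g.z x μ ^ (-q) : Circle) : ℂ) • (g.U x μ : Matrix (Fin 3) (Fin 3) ℂ).map star]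

/-- The forward covariant derivative
`(∇_μ χ)(x) = diag (z^q U, z^{-q} U*) χ(x + μ̂) - χ(x)` with the boundary conditions of `χ`. -/
def nabla (g : GaugeField T L) (q : ℤ) (μ : Fin 4) :
    Matrix (SCDIndex T L) (SCDIndex T L) ℂ :=
  Matrix.of (fun a b => if b.1 = a.1.shift μ
    then (g.link q a.1.toPoint μ * a.1.twist μ) a.2 b.2 else 0) - 1

/-- The Wilson-Dirac operator `½ ∑_μ {γ_μ (∇_μ - ∇_μ†) + r ∇_μ† ∇_μ}`, with Wilson
parameter `r`. -/
def wilson (g : GaugeField T L) (γ : Fin 4 → SpinMatrix) (q : ℤ) (r : ℝ) :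
    Matrix (Index T L) (Index T L) ℂ :=
  (1 / 2 : ℂ) • ∑ μ : Fin 4,
    ((g.nabla q μ - (g.nabla q μ).conjTranspose) ⊗ₖ γ μ
      + (r : ℂ) • (((g.nabla q μ).conjTranspose * g.nabla q μ) ⊗ₖ (1 : SpinMatrix)))

/-- The `SU(3)` field tensor `diag (Ĝ, -Ĝ*)`. -/
def tensorSU3 (g : GaugeField T L) (μ ν : Fin 4) (x : Point) : CDMatrix :=
  let G := fieldTensor (fun y ρ => (g.U y ρ : Matrix (Fin 3) (Fin 3) ℂ)) μ ν x
  Matrix.blockDiagonal ![G, -G.map star]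

/-- The `U(1)` field tensor `diag (F̂, -F̂*)`. -/
def tensorU1 (g : GaugeField T L) (μ ν : Fin 4) (x : Point) : CDMatrix :=
  let F := fieldTensor (fun y ρ => (g.z y ρ : ℂ)) μ ν x
  Matrix.blockDiagonal ![F • (1 : Matrix (Fin 3) (Fin 3) ℂ), -(star F) • 1]

/-- The Sheikholeslami-Wohlert term. -/
def swTerm (g : GaugeField T L) (γ : Fin 4 → SpinMatrix) (q : ℤ) (c3 c1 : ℝ) :
    Matrix (Index T L) (Index T L) ℂ :=
  (-(1 / 4) : ℂ) • ∑ μ : Fin 4, ∑ ν : Fin 4,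
    Matrix.of (fun a b : SCDIndex T L => if a.1 = b.1
      then ((c3 : ℂ) • g.tensorSU3 μ ν a.1.toPoint
        + ((q : ℂ) * (c1 : ℂ)) • g.tensorU1 μ ν a.1.toPoint) a.2 b.2
      else 0) ⊗ₖ sigma γ μ ν

/-- The Dirac operator `D = m + D_w + δD_sw`. -/
def dirac (g : GaugeField T L) (γ : Fin 4 → SpinMatrix) (q : ℤ) (r c3 c1 m : ℝ) :
    Matrix (Index T L) (Index T L) ℂ :=
  (m : ℂ) • 1 + g.wilson γ q r + g.swTerm γ q c3 c1

/-- `Q = γ₅ D`. -/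
def hermDirac (g : GaugeField T L) (γ : Fin 4 → SpinMatrix) (q : ℤ) (r c3 c1 m : ℝ) :
    Matrix (Index T L) (Index T L) ℂ :=
  ((1 : Matrix (SCDIndex T L) (SCDIndex T L) ℂ) ⊗ₖ gamma5 γ) * g.dirac γ q r c3 c1 m

/-- The matrix `C K D`. -/
def ckd (g : GaugeField T L) (γ : Fin 4 → SpinMatrix) (q : ℤ) (r c3 c1 m : ℝ) :
    Matrix (Index T L) (Index T L) ℂ :=
  ((1 : Matrix (SCDIndex T L) (SCDIndex T L) ℂ) ⊗ₖ chargeConj γ)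
    * (((1 : Matrix (Site T L) (Site T L) ℂ) ⊗ₖ Kcd) ⊗ₖ (1 : SpinMatrix))
    * g.dirac γ q r c3 c1 m

end GaugeField

/-- The lexicographic numbering of the basis (site, colour, doublet, spin) that a numbering `s` of
the sites gives. Another order of these four factors differs from it by an even permutation, so
that the pfaffian is the same. -/
def numbering (s : Site T L ≃ Fin (T * L ^ 3)) : Index T L ≃ Fin (2 * (12 * (T * L ^ 3))) :=
  ((((s.prodCongr finProdFinEquiv).trans finProdFinEquiv).prodCongr
    (Equiv.refl (Fin 4))).trans finProdFinEquiv).trans (finCongr (by ring))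

/-- `ev` lists the eigenvalues of `A`, each of them a number of times equal to half its degeneracy
(the dimension of the eigenspace). In particular every eigenvalue is real and in the list. -/
def IsHalvedSpectrum {ι : Type*} [Fintype ι] [DecidableEq ι] {N : ℕ} (A : Matrix ι ι ℂ)
    (ev : Fin N → ℝ) : Prop :=
  ∀ μ : ℂ, Module.finrank ℂ (Module.End.eigenspace (Matrix.toLin' A) μ)
    = 2 * Nat.card {n : Fin N // (ev n : ℂ) = μ}

end

end CStar

/-!
Put `J = C K γ₅`, so that `C K D = J Q` with `Q = γ₅ D`.

The Dirac operator is `γ₅`-hermitian, `Dᴴ = γ₅ D γ₅`, and charge conjugation together with the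
exchange of quark and antiquark transposes it, `Dᵀ = C K D K C`
(`CStar.GaugeField.isDiracLike_dirac`; both are checked on each tensor product of a lattice matrix
and a spin matrix). As `C K` is antisymmetric with square one, the second identity says that
`C K D` is antisymmetric. As `J` is hermitian, antisymmetric and of square one, the two identities
together say that the hermitian matrix `Q` commutes with the antiunitary map `v ↦ J v*`, whose
square is `-1`. This is the situation of Kramers' degeneracy (`CStar.IsKramers`): `v` and `J v*` are
orthogonal eigenvectors with the same eigenvalue, and choosing such pairs one after the other gives
a unitary matrix `W` with `Q W = W diag (λ₁, λ₁, λ₂, λ₂, …)` for which `Wᵀ J W` is the standard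
symplectic matrix `E` (`CStar.IsKramers.exists_frame`). The list of the `λₙ` is the halved spectrum.

Under a congruence the pfaffian obeys `pf (Bᵀ A B) = det B · pf A`
(`CStar.pfaffian_congruence`), since both sides are alternating multilinear in the columns of `B`.
Hence `det W · pf J = pf E`. Likewise `Wᵀ (J Q) W = E diag (λ₁, λ₁, …) = Sᵀ E S` with
`S = diag (λ₁, 1, λ₂, 1, …)`, so that `det W · pf (J Q) = ∏ λₙ · pf E`, and together
`pf (J Q) = ∏ λₙ · pf J` (`CStar.pfaffian_mul_of_frame`).

The overall sign remains, `pf J = 1` (`CStar.pfaffian_bigCK_mul_bigGamma5`). Here `J` is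
`K ⊗ (C γ₅)` at each site and colour, and a congruence of determinant one, made of a rotation of the
doublet and a spin matrix acting on the antiquarks alone, carries it to the standard symplectic
matrix in the lexicographic basis. This uses only that `C γ₅` is antisymmetric of determinant one.
-/

namespace CStar

open Matrix

/-! ### The pfaffian under congruence -/

/-- The sum in the definition of the pfaffian, for a basis that comes in pairs `(i, 0), (i, 1)`. -/
noncomputable def pairingSum {α : Type*} [Fintype α] [DecidableEq α]
    (A : Matrix (α × Fin 2) (α × Fin 2) ℂ) : ℂ :=
  ∑ σ : Equiv.Perm (α × Fin 2), ((Equiv.Perm.sign σ : ℤ) : ℂ) * ∏ i, A (σ (i, 0)) (σ (i, 1))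

/-- The standard symplectic matrix: an orthogonal sum of blocks `!![0, 1; -1, 0]`. -/
noncomputable def stdSymplectic (α : Type*) [DecidableEq α] : Matrix (α × Fin 2) (α × Fin 2) ℂ :=
  (1 : Matrix α α ℂ) ⊗ₖ !![0, 1; -1, 0]

section Pfaffian

variable {α : Type*} [Fintype α] [DecidableEq α]

theorem prod_erase_update (A : Matrix (α × Fin 2) (α × Fin 2) ℂ) (v : α × Fin 2 → α × Fin 2 → ℂ)
    (i : α) (s : Fin 2) (z : α × Fin 2 → ℂ) :
    ∏ k ∈ Finset.univ.erase i, Function.update v (i, s) z (k, 0) ⬝ᵥ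
        A *ᵥ Function.update v (i, s) z (k, 1)
      = ∏ k ∈ Finset.univ.erase i, v (k, 0) ⬝ᵥ A *ᵥ v (k, 1) := by
  refine Finset.prod_congr rfl fun k hk => ?_
  have hk' := Finset.ne_of_mem_erase hk
  rw [Function.update_of_ne (by simp [hk']), Function.update_of_ne (by simp [hk'])]

/-- The multilinear form `v ↦ ∏ i, v (i, 0) ⬝ᵥ A *ᵥ v (i, 1)`. -/
noncomputable def pairingForm (A : Matrix (α × Fin 2) (α × Fin 2) ℂ) :
    MultilinearMap ℂ (fun _ : α × Fin 2 => α × Fin 2 → ℂ) ℂ :=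
  MultilinearMap.mk' (fun v => ∏ i, v (i, 0) ⬝ᵥ A *ᵥ v (i, 1))
    (by
      rintro v ⟨i, s⟩ x y
      simp only [← Finset.mul_prod_erase Finset.univ _ (Finset.mem_univ i)]
      simp only [prod_erase_update, ← add_mul]
      congr 1
      fin_cases s
      · simp [add_dotProduct]
      · simp [mulVec_add, dotProduct_add])
    (by
      rintro v ⟨i, s⟩ c x
      simp only [← Finset.mul_prod_erase Finset.univ _ (Finset.mem_univ i)]
      simp only [prod_erase_update, smul_eq_mul, ← mul_assoc]
      congr 1
      fin_cases s
      · simp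
      · simp [mulVec_smul])

theorem alternatization_pairingForm_apply (A B : Matrix (α × Fin 2) (α × Fin 2) ℂ) :
    MultilinearMap.alternatization (pairingForm A) (fun j => Bᵀ j) = pairingSum (Bᵀ * A * B) := by
  rw [MultilinearMap.alternatization_apply, pairingSum]
  refine Finset.sum_congr rfl fun σ _ => ?_
  rw [MultilinearMap.domDomCongr_apply]
  simp only [Units.smul_def, zsmul_eq_mul]
  congr 1
  refine Finset.prod_congr rfl fun i _ => ?_
  rw [Matrix.mul_assoc, Matrix.mul_apply']
  rfl

/-- The pairing sum is multiplied by `det B` under the congruence by `B`, because it is the value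
of an alternating form of top degree on the columns of `B`. -/
theorem pairingSum_congruence (A B : Matrix (α × Fin 2) (α × Fin 2) ℂ) :
    pairingSum (Bᵀ * A * B) = B.det * pairingSum A := by
  have h := AlternatingMap.eq_smul_basis_det
    (Pi.basisFun ℂ (α × Fin 2)) (MultilinearMap.alternatization (pairingForm A))
  have hB := congrArg (fun f => f (fun j => Bᵀ j)) h
  have h1 : (fun j => (1 : Matrix (α × Fin 2) (α × Fin 2) ℂ)ᵀ j) = Pi.basisFun ℂ (α × Fin 2) := by
    funext j
    ext k
    simp [Pi.single_apply, Matrix.one_apply]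
  have h2 := alternatization_pairingForm_apply A 1
  rw [h1] at h2
  simp only [alternatization_pairingForm_apply, AlternatingMap.smul_apply, h2] at hB
  rw [hB]
  have h3 : (Pi.basisFun ℂ (α × Fin 2)).det (fun j => Bᵀ j) = B.det := by
    rw [Pi.basisFun_det_apply]
    exact det_transpose B
  rw [h3]
  simp [mul_comm]

/-- The permutations that contribute to the pairing sum of the standard symplectic matrix permute
the pairs and then, possibly, the two elements of each pair; the sign cancels the signs of the
matrix entries. -/
theorem pairingSum_stdSymplectic :
    pairingSum (stdSymplectic α)
      = 2 ^ Fintype.card α * ((Fintype.card α).factorial : ℂ) := by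
  -- `φ` parametrizes the permutations that map each pair to a pair.
  let φ : Equiv.Perm α × (α → Equiv.Perm (Fin 2)) → Equiv.Perm (α × Fin 2) := fun p =>
    (Equiv.prodCongrRight p.2).trans (Equiv.prodCongrLeft fun _ => p.1)
  have φ_apply : ∀ p i s, φ p (i, s) = (p.1 i, p.2 i s) := fun p i s => rfl
  have ε_apply : ∀ π : Equiv.Perm (Fin 2),
      (!![0, 1; -1, 0] : Matrix (Fin 2) (Fin 2) ℂ) (π 0) (π 1)
        = ((Equiv.Perm.sign π : ℤ) : ℂ) := by
    intro π
    have : π = 1 ∨ π = Equiv.swap 0 1 := by revert π; decide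
    rcases this with rfl | rfl <;> simp
  -- The permutation of the pairs acts on both elements of each pair and is even.
  have hsign : ∀ p, ((Equiv.Perm.sign (φ p) : ℤ) : ℂ)
      = ∏ i, ((Equiv.Perm.sign (p.2 i) : ℤ) : ℂ) := by
    intro p
    simp only [φ, Equiv.Perm.sign_trans, Equiv.Perm.sign_prodCongrRight,
      Equiv.Perm.sign_prodCongrLeft]
    simp
  have hterm : ∀ p, ((Equiv.Perm.sign (φ p) : ℤ) : ℂ) *
      ∏ i, stdSymplectic α (φ p (i, 0)) (φ p (i, 1)) = 1 := by
    intro p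
    rw [hsign, ← Finset.prod_mul_distrib]
    refine Finset.prod_eq_one fun i _ => ?_
    rw [φ_apply, φ_apply, stdSymplectic, kroneckerMap_apply, ε_apply, one_apply_eq, one_mul]
    rcases Int.units_eq_one_or (Equiv.Perm.sign (p.2 i)) with h | h <;> simp [h]
  have hinj : Function.Injective φ := by
    intro p p' h
    have h' : ∀ i s, p.1 i = p'.1 i ∧ p.2 i s = p'.2 i s := fun i s => by
      have := congrArg (fun e : Equiv.Perm (α × Fin 2) => e (i, s)) h
      simpa [φ_apply] using this
    refine Prod.ext (Equiv.ext fun i => (h' i 0).1) (funext fun i => Equiv.ext fun s => (h' i s).2)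
  have hsurj : ∀ σ : Equiv.Perm (α × Fin 2),
      (∀ i, (σ (i, 0)).1 = (σ (i, 1)).1) → σ ∈ Set.range φ := by
    intro σ hσ
    have hfst : ∀ i s, (σ (i, s)).1 = (σ (i, 0)).1 := by
      intro i s
      fin_cases s
      · rfl
      · exact (hσ i).symm
    have hsnd : ∀ i, Function.Injective fun s => (σ (i, s)).2 := by
      intro i s t h
      have : σ (i, s) = σ (i, t) := Prod.ext ((hfst i s).trans (hfst i t).symm) h
      simpa using this
    have hτ : Function.Surjective fun i => (σ (i, 0)).1 := by
      intro k
      obtain ⟨⟨i, s⟩, h⟩ := σ.surjective (k, 0)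
      exact ⟨i, by simp only [← hfst i s, h]⟩
    refine ⟨(Equiv.ofBijective _ (Finite.surjective_iff_bijective.mp hτ),
      fun i => Equiv.ofBijective _ (Finite.injective_iff_bijective.mp (hsnd i))), ?_⟩
    ext1 ⟨i, s⟩
    rw [φ_apply]
    exact Prod.ext (hfst i s).symm rfl
  have hsum : pairingSum (stdSymplectic α)
      = ∑ p : Equiv.Perm α × (α → Equiv.Perm (Fin 2)), (1 : ℂ) := by
    symm
    refine Finset.sum_of_injOn φ hinj.injOn (by simp) ?_ fun p _ => (hterm p).symm
    intro σ _ hσ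
    have : ∃ i, (σ (i, 0)).1 ≠ (σ (i, 1)).1 := by
      by_contra! h
      exact hσ (by simpa using hsurj σ h)
    obtain ⟨i, hi⟩ := this
    refine mul_eq_zero_of_right _ (Finset.prod_eq_zero (Finset.mem_univ i) ?_)
    rw [stdSymplectic, kroneckerMap_apply, one_apply_ne hi, zero_mul]
  rw [hsum]
  simp [Fintype.card_perm, mul_comm]

/-- The numbering `(i, s) ↦ 2 i + s`. -/
def pairEquiv (n : ℕ) : Fin n × Fin 2 ≃ Fin (2 * n) :=
  finProdFinEquiv.trans (finCongr (by ring))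

theorem pairEquiv_val {n : ℕ} (p : Fin n × Fin 2) :
    (pairEquiv n p : ℕ) = 2 * p.1 + p.2 := by
  simp [pairEquiv, finProdFinEquiv, add_comm]

theorem pfaffian_eq_pairingSum {n : ℕ} (A : Matrix (Fin (2 * n)) (Fin (2 * n)) ℂ) :
    pfaffian A = 1 / (2 ^ n * (n.factorial : ℂ)) *
      pairingSum (A.submatrix (pairEquiv n) (pairEquiv n)) := by
  rw [pfaffian, pairingSum]
  congr 1
  refine (Fintype.sum_equiv (pairEquiv n).permCongr _ _ fun σ => ?_).symm
  rw [Equiv.Perm.sign_permCongr]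
  congr 1
  refine Finset.prod_congr rfl fun i _ => ?_
  have h : ∀ (s : Fin 2) (h : 2 * i.1 + s.1 < 2 * n),
      (pairEquiv n).symm ⟨2 * i.1 + s.1, h⟩ = (i, s) := by
    intro s h
    rw [Equiv.symm_apply_eq]
    ext
    rw [pairEquiv_val]
  have h0 := h 0 (by rw [Fin.val_zero]; omega)
  have h1 := h 1 (by rw [Fin.val_one]; omega)
  simp only [Fin.val_zero, Fin.val_one, add_zero] at h0 h1
  simp [Equiv.permCongr_apply, h0, h1]

theorem pfaffian_congruence {n : ℕ} (A B : Matrix (Fin (2 * n)) (Fin (2 * n)) ℂ) :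
    pfaffian (Bᵀ * A * B) = B.det * pfaffian A := by
  have h : (Bᵀ * A * B).submatrix (pairEquiv n) (pairEquiv n)
      = (B.submatrix (pairEquiv n) (pairEquiv n))ᵀ * A.submatrix (pairEquiv n) (pairEquiv n) *
        B.submatrix (pairEquiv n) (pairEquiv n) := by
    rw [transpose_submatrix, submatrix_mul_equiv, submatrix_mul_equiv]
  rw [pfaffian_eq_pairingSum, pfaffian_eq_pairingSum, h, pairingSum_congruence,
    det_submatrix_equiv_self]
  ring

theorem pfaffian_stdSymplectic (n : ℕ) :
    pfaffian ((stdSymplectic (Fin n)).reindex (pairEquiv n) (pairEquiv n)) = 1 := by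
  rw [pfaffian_eq_pairingSum, reindex_apply, submatrix_submatrix, Equiv.symm_comp_self,
    submatrix_id_id, pairingSum_stdSymplectic, Fintype.card_fin]
  have : (n.factorial : ℂ) ≠ 0 := by exact_mod_cast n.factorial_ne_zero
  field_simp

end Pfaffian

/-! ### Kramers pairs of eigenvectors -/

section Kramers

variable {ι : Type*} [Fintype ι] [DecidableEq ι]

/-- A hermitian matrix `Q` that commutes with the antiunitary map `v ↦ J *ᵥ star v`, whose square
is `-1`. -/
structure IsKramers (J Q : Matrix ι ι ℂ) : Prop where
  isHermitian_left : J.IsHermitian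
  transpose_left : Jᵀ = -J
  mul_self_left : J * J = 1
  isHermitian_right : Q.IsHermitian
  transpose_right : Qᵀ = J * Q * J

/-- The orthogonal complement of fewer eigenvectors than the dimension is invariant, and so it
contains a further eigenvector. -/
theorem exists_eigenvector_orthogonal {κ : Type*} [Fintype κ] {Q : Matrix ι ι ℂ}
    (hQ : Q.IsHermitian) (hκ : Fintype.card κ < Fintype.card ι) (w : κ → ι → ℂ) (c : κ → ℝ)
    (hw : ∀ i, Q *ᵥ w i = (c i : ℂ) • w i) :
    ∃ (x : ι → ℂ) (ev : ℝ), Q *ᵥ x = (ev : ℂ) • x ∧ star x ⬝ᵥ x = 1 ∧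
      ∀ i, star (w i) ⬝ᵥ x = 0 := by
  set f : κ → EuclideanSpace ℂ ι := fun i => WithLp.toLp 2 (w i) with hf
  set S : Submodule ℂ (EuclideanSpace ℂ ι) := Submodule.span ℂ (Set.range f) with hS
  have hmem : ∀ x : EuclideanSpace ℂ ι, x ∈ Sᗮ ↔ ∀ i, star (w i) ⬝ᵥ WithLp.ofLp x = 0 := by
    intro x
    rw [Submodule.mem_orthogonal]
    have hf' : ∀ i, inner ℂ (f i) x = star (w i) ⬝ᵥ WithLp.ofLp x := fun i => by
      rw [EuclideanSpace.inner_eq_star_dotProduct, dotProduct_comm]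
    refine ⟨fun hx i => ?_, fun hx u hu => ?_⟩
    · rw [← hf']
      exact hx _ (Submodule.subset_span ⟨i, rfl⟩)
    · induction hu using Submodule.span_induction with
      | mem u hu =>
        obtain ⟨i, rfl⟩ := hu
        rw [hf', hx]
      | zero => exact inner_zero_left _
      | add u u' _ _ h h' => rw [inner_add_left, h, h', add_zero]
      | smul a u _ h => rw [inner_smul_left, h, mul_zero]
  have hT : Q.toEuclideanLin.IsSymmetric := isSymmetric_toEuclideanLin_iff.mpr hQ
  have hinv : ∀ x ∈ Sᗮ, Q.toEuclideanLin x ∈ Sᗮ := by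
    intro x hx
    rw [hmem] at hx ⊢
    intro i
    have : star (w i) ᵥ* Q = (c i : ℂ) • star (w i) := by
      have h := congrArg star (hw i)
      rw [star_mulVec, hQ.eq, star_smul] at h
      simpa using h
    rw [ofLp_toLpLin, toLin'_apply, dotProduct_mulVec, this, smul_dotProduct, hx i, smul_zero]
  have hnt : Nontrivial Sᗮ := by
    rw [Submodule.nontrivial_iff_ne_bot]
    intro h
    have h1 := Submodule.finrank_add_finrank_orthogonal S
    rw [h, finrank_bot, finrank_euclideanSpace] at h1
    have h2 : Module.finrank ℂ S ≤ Fintype.card κ := finrank_range_le_card f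
    omega
  obtain ⟨μ, hμ⟩ := Module.End.exists_eigenvalue (Q.toEuclideanLin.restrict hinv)
  have hreal := (hT.restrict_invariant hinv).conj_eigenvalue_eq_self hμ
  obtain ⟨y, hy⟩ := hμ.exists_hasEigenvector
  have hy1 : Q *ᵥ WithLp.ofLp (y : EuclideanSpace ℂ ι)
      = μ • WithLp.ofLp (y : EuclideanSpace ℂ ι) := by
    have := congrArg (fun z : Sᗮ => WithLp.ofLp (z : EuclideanSpace ℂ ι)) hy.apply_eq_smul
    simpa using this
  have hy0 : (y : EuclideanSpace ℂ ι) ≠ 0 := by simpa using hy.2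
  have hn : (‖(y : EuclideanSpace ℂ ι)‖ : ℂ) ≠ 0 := by simpa using hy0
  refine ⟨((‖(y : EuclideanSpace ℂ ι)‖ : ℂ)⁻¹) • WithLp.ofLp (y : EuclideanSpace ℂ ι), μ.re,
    ?_, ?_, ?_⟩
  · rw [mulVec_smul, hy1, Complex.conj_eq_iff_re.mp hreal, smul_comm]
  · have h := inner_self_eq_norm_sq_to_K (𝕜 := ℂ) (y : EuclideanSpace ℂ ι)
    rw [EuclideanSpace.inner_eq_star_dotProduct, dotProduct_comm] at h
    rw [star_smul, smul_dotProduct, dotProduct_smul, h]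
    simp only [star_inv₀, smul_eq_mul, RCLike.star_def, Complex.conj_ofReal]
    change _ * (_ * (‖(y : EuclideanSpace ℂ ι)‖ : ℂ) ^ 2) = 1
    field_simp
  · intro i
    rw [dotProduct_smul, (hmem _).mp y.2 i, smul_zero]

namespace IsKramers

variable {J Q : Matrix ι ι ℂ} (h : IsKramers J Q)
include h

/-- The form `v ⬝ᵥ J *ᵥ w` is alternating. -/
theorem skew (v w : ι → ℂ) : v ⬝ᵥ J *ᵥ w = -(w ⬝ᵥ J *ᵥ v) := by
  rw [dotProduct_mulVec, ← mulVec_transpose, h.transpose_left, neg_mulVec, neg_dotProduct,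
    dotProduct_comm]

theorem skew_self (v : ι → ℂ) : v ⬝ᵥ J *ᵥ v = 0 := by
  have := h.skew v v
  linear_combination this / 2

/-- The inner product with the Kramers partner is the symplectic form of `J`. -/
theorem star_conj_dotProduct (v w : ι → ℂ) : star (J *ᵥ star v) ⬝ᵥ w = v ⬝ᵥ J *ᵥ w := by
  rw [star_mulVec, star_star, h.isHermitian_left.eq, dotProduct_mulVec]

theorem mulVec_mulVec_self (v : ι → ℂ) : J *ᵥ J *ᵥ v = v := by
  rw [mulVec_mulVec, h.mul_self_left, one_mulVec]

/-- The Kramers partner of an eigenvector has the same eigenvalue. -/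
theorem mulVec_conj {v : ι → ℂ} {c : ℝ} (hv : Q *ᵥ v = (c : ℂ) • v) :
    Q *ᵥ J *ᵥ star v = (c : ℂ) • J *ᵥ star v := by
  have h1 : Q * J = J * Qᵀ := by
    rw [h.transpose_right, ← Matrix.mul_assoc, ← Matrix.mul_assoc, h.mul_self_left, Matrix.one_mul]
  have h2 : Qᵀ *ᵥ star v = (c : ℂ) • star v := by
    have := congrArg star hv
    rw [star_mulVec, h.isHermitian_right.eq, star_smul] at this
    rw [mulVec_transpose]
    simpa using this
  rw [mulVec_mulVec, h1, ← mulVec_mulVec, h2, mulVec_smul]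

/-- Eigenvectors are chosen one after the other, each orthogonal to the earlier ones and to their
Kramers partners. -/
theorem exists_orthonormal_eigenvectors (k : ℕ) (hk : 2 * k ≤ Fintype.card ι) :
    ∃ (v : Fin k → ι → ℂ) (ev : Fin k → ℝ),
      (∀ i j, star (v i) ⬝ᵥ v j = if i = j then 1 else 0) ∧
      (∀ i j, v i ⬝ᵥ J *ᵥ v j = 0) ∧ ∀ i, Q *ᵥ v i = (ev i : ℂ) • v i := by
  induction k with
  | zero => exact ⟨fun _ => 0, fun _ => 0, fun i => i.elim0, fun i => i.elim0, fun i => i.elim0⟩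
  | succ k ih =>
    obtain ⟨v, ev, h1, h2, h3⟩ := ih (by omega)
    obtain ⟨x, c, hx, hxx, hvx⟩ := exists_eigenvector_orthogonal (κ := Fin k ⊕ Fin k)
      h.isHermitian_right (by simp; omega) (Sum.elim v fun i => J *ᵥ star (v i)) (Sum.elim ev ev)
      (by rintro (i | i); exacts [h3 i, h.mulVec_conj (h3 i)])
    have hx1 : ∀ i, star (v i) ⬝ᵥ x = 0 := fun i => hvx (.inl i)
    have hx2 : ∀ i, v i ⬝ᵥ J *ᵥ x = 0 := fun i => by
      rw [← h.star_conj_dotProduct]; exact hvx (.inr i)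
    have hx3 : ∀ i, star x ⬝ᵥ v i = 0 := fun i => by
      rw [star_dotProduct, hx1, star_zero]
    refine ⟨Fin.cons x v, Fin.cons c ev, ?_, ?_, ?_⟩
    · intro i j
      cases i using Fin.cases <;> cases j using Fin.cases <;>
        simp [hxx, hx1, hx3, h1, Fin.succ_ne_zero, (Fin.succ_ne_zero _).symm]
    · intro i j
      cases i using Fin.cases <;> cases j using Fin.cases
      · exact h.skew_self x
      · rw [h.skew]; simp [hx2]
      · simp [hx2]
      · simp [h2]
    · intro i
      cases i using Fin.cases <;> simp [hx, h3]

/-- The orthonormal eigenvectors and their Kramers partners form a unitary matrix that diagonalizes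
`Q` and is a symplectic frame for `J`. -/
theorem exists_frame {N : ℕ} (hN : Fintype.card ι = 2 * N) :
    ∃ (W : Matrix ι (Fin N × Fin 2) ℂ) (ev : Fin N → ℝ),
      Wᴴ * W = 1 ∧ Wᵀ * J * W = stdSymplectic (Fin N) ∧
      Q * W = W * diagonal (fun p : Fin N × Fin 2 => (ev p.1 : ℂ)) := by
  obtain ⟨v, ev, h1, h2, h3⟩ := h.exists_orthonormal_eigenvectors N hN.ge
  have h1' : ∀ i j, v i ⬝ᵥ star (v j) = if i = j then 1 else 0 := fun i j => by
    rw [dotProduct_comm, h1]; simp only [eq_comm]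
  have h4 : ∀ i j, star (v i) ⬝ᵥ J *ᵥ star (v j) = 0 := fun i j => by
    rw [star_dotProduct, h.star_conj_dotProduct, h2, star_zero]
  have h4' : ∀ i j, J *ᵥ star (v i) ⬝ᵥ star (v j) = 0 := fun i j => by
    rw [dotProduct_comm, h4]
  let w : Fin N × Fin 2 → ι → ℂ := fun p => ![v p.1, J *ᵥ star (v p.1)] p.2
  refine ⟨(Matrix.of w)ᵀ, ev, ?_, ?_, ?_⟩
  · ext ⟨i, s⟩ ⟨j, t⟩
    rw [mul_apply']
    change star (w (i, s)) ⬝ᵥ w (j, t) = _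
    fin_cases s <;> fin_cases t <;>
      simp [w, h1, h1', h2, h4, h.star_conj_dotProduct, h.mulVec_mulVec_self, one_apply]
  · ext ⟨i, s⟩ ⟨j, t⟩
    rw [Matrix.mul_assoc, mul_apply']
    change w (i, s) ⬝ᵥ J *ᵥ w (j, t) = _
    fin_cases s <;> fin_cases t <;>
      simp [w, h1', h2, h4', h.skew (J *ᵥ star (v i)), h.mulVec_mulVec_self, one_apply,
        stdSymplectic, @eq_comm _ j i]
  · ext a ⟨i, s⟩
    refine Eq.trans ?_ (mul_diagonal _ _ _ _).symm
    change (Q *ᵥ w (i, s)) a = w (i, s) a * (ev i : ℂ)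
    fin_cases s
    · simp [w, h3, mul_comm]
    · simp [w, h.mulVec_conj (h3 i), mul_comm]

end IsKramers

end Kramers

/-! ### Halved spectra -/

section HalvedSpectrum

variable {ι : Type*} [Fintype ι] [DecidableEq ι]

theorem finrank_eigenspace_eq_card {κ : Type*} [Fintype κ] [DecidableEq κ] {Q : Matrix ι ι ℂ}
    {W : Matrix ι κ ℂ} {d : κ → ℂ} (hκ : Fintype.card ι = Fintype.card κ)
    (hW : Wᴴ * W = 1) (hQ : Q * W = W * diagonal d) (μ : ℂ) :
    Module.finrank ℂ (Module.End.eigenspace (Matrix.toLin' Q) μ) = Nat.card {p // d p = μ} := by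
  classical
  -- `U` is `W` with its columns renumbered to make it a square matrix.
  let e := Fintype.equivOfCardEq hκ
  have hW' : W * Wᴴ = 1 := (mul_eq_one_comm_of_equiv e.symm).mp hW
  let U : Matrix ι ι ℂ := W.submatrix id e
  have hU : U * Uᴴ = 1 := by
    rw [conjTranspose_submatrix, submatrix_mul_equiv, hW', submatrix_id_id]
  have hdet : IsUnit U.det := (isUnit_iff_isUnit_det U).mp (IsUnit.of_mul_eq_one _ hU)
  have hdet' : IsUnit Uᴴ.det := by rw [det_conjTranspose]; exact hdet.star
  have hQU : Q - μ • 1 = U * diagonal (fun a => d (e a) - μ) * Uᴴ := by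
    have h1 : Q = U * diagonal (d ∘ e) * Uᴴ := by
      rw [← submatrix_diagonal_equiv d e, submatrix_mul_equiv, ← hQ, conjTranspose_submatrix,
        submatrix_mul_equiv, Matrix.mul_assoc, hW', Matrix.mul_one, submatrix_id_id]
    have h2 : μ • (1 : Matrix ι ι ℂ) = U * diagonal (fun _ => μ) * Uᴴ := by
      rw [← smul_one_eq_diagonal, Matrix.mul_smul, Matrix.mul_one, Matrix.smul_mul, hU]
    rw [h2]
    nth_rewrite 1 [h1]
    rw [← Matrix.sub_mul, ← Matrix.mul_sub, diagonal_sub]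
    rfl
  have hker : Module.End.eigenspace (Matrix.toLin' Q) μ
      = LinearMap.ker (Matrix.toLin' (Q - μ • 1)) := by
    rw [Module.End.eigenspace_def, map_sub, map_smul, toLin'_one]
    rfl
  have hrank : Module.finrank ℂ (LinearMap.range (Matrix.toLin' (Q - μ • 1)))
      = Fintype.card {a // d (e a) - μ ≠ 0} := by
    rw [← rank_diagonal, toLin'_apply', ← Matrix.rank, hQU,
      rank_mul_eq_left_of_isUnit_det _ _ hdet', rank_mul_eq_right_of_isUnit_det _ _ hdet]
  have hsum := LinearMap.finrank_range_add_finrank_ker (Matrix.toLin' (Q - μ • 1))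
  have hcompl : Fintype.card {a // d (e a) - μ = 0} + Fintype.card {a // d (e a) - μ ≠ 0}
      = Fintype.card ι := by
    rw [Fintype.card_subtype, Fintype.card_subtype]
    exact Finset.card_filter_add_card_filter_not _
  have hcard : Fintype.card {a // d (e a) - μ = 0} = Nat.card {p // d p = μ} := by
    rw [← Nat.card_eq_fintype_card]
    exact Nat.card_congr (e.subtypeEquiv fun a => sub_eq_zero)
  rw [hker, ← hcard]
  rw [hrank, Module.finrank_fintype_fun_eq_card] at hsum
  omega

theorem isHalvedSpectrum_of_frame {N : ℕ} (hN : Fintype.card ι = 2 * N) {Q : Matrix ι ι ℂ}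
    {W : Matrix ι (Fin N × Fin 2) ℂ} {ev : Fin N → ℝ} (hW : Wᴴ * W = 1)
    (hQ : Q * W = W * diagonal (fun p : Fin N × Fin 2 => (ev p.1 : ℂ))) :
    IsHalvedSpectrum Q ev := by
  intro μ
  rw [finrank_eigenspace_eq_card (by simp [hN, mul_comm]) hW hQ μ]
  rw [Nat.card_congr (Equiv.prodSubtypeFstEquivSubtypeProd
    (p := fun n => (ev n : ℂ) = μ) (β := Fin 2)), Nat.card_prod]
  simp [mul_comm]

/-- A halved spectrum is determined by the matrix up to the order of the list. -/
theorem prod_eq_of_isHalvedSpectrum {N : ℕ} {Q : Matrix ι ι ℂ} {ev ev' : Fin N → ℝ}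
    (h : IsHalvedSpectrum Q ev) (h' : IsHalvedSpectrum Q ev') : ∏ n, ev n = ∏ n, ev' n := by
  have : Finset.univ.val.map ev = Finset.univ.val.map ev' := by
    ext c
    have hc := (h c).symm.trans (h' c)
    simp only [Complex.ofReal_inj, Nat.card_eq_fintype_card, Fintype.card_subtype] at hc
    simp only [Multiset.count_map, @eq_comm _ c]
    exact Nat.eq_of_mul_eq_mul_left two_pos hc
  exact congrArg Multiset.prod this

theorem sign_prod_eq_neg_one_pow {N : ℕ} {ev : Fin N → ℝ} (h : ∏ n, ev n ≠ 0) :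
    Real.sign (∏ n, ev n) = (-1) ^ Nat.card {n // ev n < 0} := by
  have hmul : ∀ x y : ℝ, Real.sign (x * y) = Real.sign x * Real.sign y := by
    intro x y
    rcases lt_trichotomy x 0 with hx | rfl | hx <;> rcases lt_trichotomy y 0 with hy | rfl | hy <;>
      simp [Real.sign_of_neg, Real.sign_of_pos, mul_pos_of_neg_of_neg, mul_neg_of_neg_of_pos,
        mul_neg_of_pos_of_neg, *]
  let f : ℝ →* ℝ := ⟨⟨Real.sign, Real.sign_one⟩, hmul⟩
  have h1 : Real.sign (∏ n, ev n) = ∏ n, Real.sign (ev n) := map_prod f ev Finset.univ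
  have h2 : ∀ n, Real.sign (ev n) = if ev n < 0 then -1 else 1 := by
    intro n
    have hn : ev n ≠ 0 := Finset.prod_ne_zero_iff.mp h n (Finset.mem_univ n)
    split_ifs with hneg
    · exact Real.sign_of_neg hneg
    · exact Real.sign_of_pos (lt_of_le_of_ne (not_lt.mp hneg) hn.symm)
  rw [h1, Finset.prod_congr rfl fun n _ => h2 n, Finset.prod_ite]
  simp [Fintype.card_subtype]

omit [DecidableEq ι] in
/-- In a symplectic frame for `J` that diagonalizes `Q`, the matrix `J * Q` is a rescaling of `J`
by `ev n` in one vector of each pair. -/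
theorem pfaffian_mul_of_frame {N : ℕ} (e : ι ≃ Fin (2 * N)) {J Q : Matrix ι ι ℂ}
    {W : Matrix ι (Fin N × Fin 2) ℂ} {ev : Fin N → ℝ} (hW : Wᴴ * W = 1)
    (hJ : Wᵀ * J * W = stdSymplectic (Fin N))
    (hQ : Q * W = W * diagonal (fun p : Fin N × Fin 2 => (ev p.1 : ℂ))) :
    pfaffian ((J * Q).reindex e e) = (∏ n, (ev n : ℂ)) * pfaffian (J.reindex e e) := by
  let E := (stdSymplectic (Fin N)).reindex (pairEquiv N) (pairEquiv N)
  let X : Matrix (Fin (2 * N)) (Fin (2 * N)) ℂ := W.submatrix e.symm (pairEquiv N).symm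
  -- Congruence by `S` multiplies the `n`-th symplectic block by `ev n`.
  let S : Matrix (Fin N × Fin 2) (Fin N × Fin 2) ℂ :=
    diagonal fun p => if p.2 = 0 then (ev p.1 : ℂ) else 1
  have hX : Xᴴ * X = 1 := by
    rw [conjTranspose_submatrix, submatrix_mul_equiv, hW, submatrix_one_equiv]
  have hdet : X.det ≠ 0 := by
    intro h0
    have := congrArg det hX
    rw [det_mul, h0, mul_zero, det_one] at this
    exact zero_ne_one this
  have hdetS : S.det = ∏ n, (ev n : ℂ) := by
    rw [det_diagonal, Fintype.prod_prod_type]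
    simp
  have hS : stdSymplectic (Fin N) * diagonal (fun p : Fin N × Fin 2 => (ev p.1 : ℂ))
      = Sᵀ * stdSymplectic (Fin N) * S := by
    ext ⟨i, s⟩ ⟨j, t⟩
    rw [diagonal_transpose, mul_diagonal, mul_diagonal, diagonal_mul, stdSymplectic,
      kroneckerMap_apply]
    by_cases hij : i = j
    · subst hij
      fin_cases s <;> fin_cases t <;> simp
    · simp [one_apply_ne hij]
  have h1 : Xᵀ * J.reindex e e * X = E := by
    rw [reindex_apply, transpose_submatrix, submatrix_mul_equiv, submatrix_mul_equiv, hJ]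
    rfl
  have h2 : Xᵀ * (J * Q).reindex e e * X
      = (S.reindex (pairEquiv N) (pairEquiv N))ᵀ * E * S.reindex (pairEquiv N) (pairEquiv N) := by
    rw [reindex_apply, transpose_submatrix, submatrix_mul_equiv, submatrix_mul_equiv,
      ← Matrix.mul_assoc, Matrix.mul_assoc, hQ, ← Matrix.mul_assoc, hJ, hS, reindex_apply,
      show E = (stdSymplectic (Fin N)).submatrix (pairEquiv N).symm (pairEquiv N).symm from rfl,
      transpose_submatrix, submatrix_mul_equiv, submatrix_mul_equiv]
  have h3 := pfaffian_congruence (J.reindex e e) X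
  have h4 := pfaffian_congruence ((J * Q).reindex e e) X
  rw [h1] at h3
  rw [h2, pfaffian_congruence, h3, det_reindex_self, hdetS] at h4
  refine mul_left_cancel₀ hdet ?_
  rw [← h4]
  ring

end HalvedSpectrum

/-! ### Gamma matrix algebra -/

namespace IsChiralBasis

variable {γ : Fin 4 → SpinMatrix} (h : IsChiralBasis γ)
include h

theorem mul_self (μ : Fin 4) : γ μ * γ μ = 1 := by
  have h1 := h.clifford μ μ
  rw [if_pos rfl, ← two_mul, ← mul_one (2 : SpinMatrix), mul_assoc, one_mul] at h1
  have h2 : (2 : ℂ) • (γ μ * γ μ) = (2 : ℂ) • (1 : SpinMatrix) := by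
    rw [two_smul, two_smul, ← two_mul, ← two_mul, h1]
  exact smul_right_injective _ two_ne_zero h2

theorem mul_self_mul (μ : Fin 4) (X : SpinMatrix) : γ μ * (γ μ * X) = X := by
  rw [← mul_assoc, h.mul_self, one_mul]

/-- Stated for `ν < μ`, so that it can be used by `simp` to sort the factors of a product. -/
theorem mul_swap {μ ν : Fin 4} (hμν : ν < μ) : γ μ * γ ν = -(γ ν * γ μ) := by
  have := h.clifford μ ν
  rw [if_neg hμν.ne'] at this
  exact eq_neg_of_add_eq_zero_left this

theorem mul_swap_mul {μ ν : Fin 4} (hμν : ν < μ) (X : SpinMatrix) :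
    γ μ * (γ ν * X) = -(γ ν * (γ μ * X)) := by
  rw [← mul_assoc, h.mul_swap hμν, neg_mul, mul_assoc]

theorem transpose_of_real {μ : Fin 4} (hμ : ∀ s t, (γ μ s t).im = 0) : (γ μ)ᵀ = γ μ := by
  nth_rewrite 2 [← h.hermitian μ]
  ext s t
  rw [transpose_apply, conjTranspose_apply]
  exact (Complex.conj_eq_iff_im.mpr (hμ t s)).symm

theorem transpose_of_imag {μ : Fin 4} (hμ : ∀ s t, (γ μ s t).re = 0) : (γ μ)ᵀ = -γ μ := by
  nth_rewrite 2 [← h.hermitian μ]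
  ext s t
  rw [transpose_apply, neg_apply, conjTranspose_apply]
  apply Complex.ext <;> simp [hμ t s]

/-- Charge conjugation of the gamma matrices. Both `γ ↦ C γ C` and transposition preserve each of
them up to a sign: the first reverses `γ₀, γ₂`, the second `γ₁, γ₃`. -/
theorem transpose_eq (μ : Fin 4) :
    (γ μ)ᵀ = -(chargeConj γ * γ μ * chargeConj γ) := by
  fin_cases μ
  · refine (h.transpose_of_real h.real_zero).trans ?_
    simp [chargeConj, mul_assoc, smul_smul, h.mul_self, h.mul_self_mul, h.mul_swap, h.mul_swap_mul]
  · refine (h.transpose_of_imag h.imag_one).trans ?_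
    simp [chargeConj, mul_assoc, smul_smul, h.mul_self, h.mul_self_mul, h.mul_swap, h.mul_swap_mul]
  · refine (h.transpose_of_real h.real_two).trans ?_
    simp [chargeConj, mul_assoc, smul_smul, h.mul_self, h.mul_self_mul]
  · refine (h.transpose_of_imag h.imag_three).trans ?_
    simp [chargeConj, mul_assoc, smul_smul, h.mul_self_mul, h.mul_swap, h.mul_swap_mul]

theorem chargeConj_mul_self : chargeConj γ * chargeConj γ = 1 := by
  simp [chargeConj, mul_assoc, smul_smul, h.mul_self, h.mul_swap_mul]

theorem chargeConj_isHermitian : (chargeConj γ).IsHermitian := by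
  rw [IsHermitian, chargeConj, conjTranspose_smul, conjTranspose_mul, h.hermitian, h.hermitian,
    h.mul_swap (show (0 : Fin 4) < 2 by decide)]
  simp

theorem chargeConj_transpose : (chargeConj γ)ᵀ = -chargeConj γ := by
  rw [chargeConj, transpose_smul, transpose_mul, h.transpose_of_real h.real_zero,
    h.transpose_of_real h.real_two, h.mul_swap (show (0 : Fin 4) < 2 by decide), smul_neg]

theorem gamma5_transpose : (gamma5 γ)ᵀ = gamma5 γ := by
  ext s t
  by_cases hst : s = t
  · rw [hst, transpose_apply]
  · rw [transpose_apply, h.gamma5_diag hst, h.gamma5_diag (Ne.symm hst)]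

theorem gamma5_mul (μ : Fin 4) : gamma5 γ * γ μ = -(γ μ * gamma5 γ) := by
  fin_cases μ <;>
    simp [gamma5, mul_assoc, h.mul_self, h.mul_self_mul, h.mul_swap, h.mul_swap_mul]

theorem gamma5_mul_self : gamma5 γ * gamma5 γ = 1 := by
  simp [gamma5, mul_assoc, h.mul_self, h.mul_swap_mul]

theorem gamma5_isHermitian : (gamma5 γ).IsHermitian := by
  simp [IsHermitian, gamma5, (h.hermitian _).eq, mul_assoc, h.mul_swap, h.mul_swap_mul]

theorem gamma5_mul_mul (μ ν : Fin 4) : gamma5 γ * (γ μ * γ ν) = γ μ * γ ν * gamma5 γ := by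
  rw [← mul_assoc, h.gamma5_mul, neg_mul, mul_assoc, h.gamma5_mul, mul_neg, neg_neg, mul_assoc]

theorem gamma5_mul_chargeConj : gamma5 γ * chargeConj γ = chargeConj γ * gamma5 γ := by
  rw [chargeConj, mul_smul_comm, h.gamma5_mul_mul, smul_mul_assoc]

theorem gamma_eq (μ : Fin 4) : γ μ = -(gamma5 γ * γ μ * gamma5 γ) := by
  rw [h.gamma5_mul, neg_mul, neg_neg, mul_assoc, h.gamma5_mul_self, mul_one]

theorem sigma_isHermitian (μ ν : Fin 4) : (sigma γ μ ν).IsHermitian := by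
  rw [IsHermitian, sigma, conjTranspose_smul, conjTranspose_sub, conjTranspose_mul,
    conjTranspose_mul, h.hermitian, h.hermitian, ← neg_sub (γ μ * γ ν), smul_neg, ← neg_smul]
  congr 1
  simp [neg_div]

theorem sigma_eq (μ ν : Fin 4) : sigma γ μ ν = gamma5 γ * sigma γ μ ν * gamma5 γ := by
  have : gamma5 γ * sigma γ μ ν = sigma γ μ ν * gamma5 γ := by
    rw [sigma, mul_smul_comm, mul_sub, h.gamma5_mul_mul, h.gamma5_mul_mul, ← sub_mul,
      smul_mul_assoc]
  rw [this, mul_assoc, h.gamma5_mul_self, mul_one]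

theorem sigma_transpose (μ ν : Fin 4) :
    (sigma γ μ ν)ᵀ = -(chargeConj γ * sigma γ μ ν * chargeConj γ) := by
  have hmul : ∀ X Y : SpinMatrix,
      chargeConj γ * X * chargeConj γ * (chargeConj γ * Y * chargeConj γ)
      = chargeConj γ * (X * Y) * chargeConj γ := by
    intro X Y
    have := h.chargeConj_mul_self
    calc _ = chargeConj γ * X * (chargeConj γ * chargeConj γ) * Y * chargeConj γ := by
            noncomm_ring
      _ = _ := by rw [this]; noncomm_ring
  rw [sigma, transpose_smul, transpose_sub, transpose_mul, transpose_mul, h.transpose_eq,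
    h.transpose_eq, neg_mul_neg, neg_mul_neg, hmul, hmul, mul_smul_comm, smul_mul_assoc, ← smul_neg,
    ← sub_mul, ← mul_sub, ← neg_mul, ← mul_neg, neg_sub]

/-- Any two gamma matrices are conjugate by their sum, so that they have the same determinant, a
sign. -/
theorem det_chargeConj_mul_gamma5 : (chargeConj γ * gamma5 γ).det = 1 := by
  have heq : ∀ μ, (γ μ).det = (γ 0).det := by
    intro μ
    rcases eq_or_ne μ 0 with rfl | hμ
    · rfl
    have h1 : (γ μ + γ 0) * γ μ = γ 0 * (γ μ + γ 0) := by
      rw [add_mul, mul_add, h.mul_self, h.mul_self, add_comm]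
    have h2 : (γ μ + γ 0) * (γ μ + γ 0) = (2 : ℂ) • 1 := by
      have := h.clifford μ 0
      rw [if_neg hμ] at this
      rw [add_mul, mul_add, mul_add, h.mul_self, h.mul_self, two_smul,
        show 1 + γ μ * γ 0 + (γ 0 * γ μ + 1) = γ μ * γ 0 + γ 0 * γ μ + (1 + 1) by abel, this,
        zero_add]
    have h3 : (γ μ + γ 0).det ≠ 0 := by
      intro h0
      have := congrArg det h2
      rw [det_mul, h0, det_smul] at this
      norm_num at this
    have h4 := congrArg det h1
    rw [det_mul, det_mul, mul_comm] at h4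
    exact mul_right_cancel₀ h3 h4
  have hsq : (γ 0).det * (γ 0).det = 1 := by
    rw [← det_mul, h.mul_self, det_one]
  rw [chargeConj, gamma5]
  simp only [det_mul, det_smul, heq, Fintype.card_fin, Complex.I_pow_four, one_mul]
  linear_combination ((γ 0).det ^ 4 + (γ 0).det ^ 2 + 1) * hsq

end IsChiralBasis

/-! ### Charge conjugation of the covariant derivative and the field tensors -/

section QuarkAntiquark

theorem Kcd_mul_self : Kcd * Kcd = 1 := by
  rw [Kcd, ← mul_kronecker_mul, Matrix.one_mul,
    show !![0, 1; 1, 0] * !![0, 1; 1, 0] = (1 : Matrix (Fin 2) (Fin 2) ℂ) by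
      simp [one_fin_two], one_kronecker_one]

theorem Kcd_transpose : Kcdᵀ = Kcd := by
  rw [Kcd, ← kroneckerMap_transpose, transpose_one]
  congr 1
  ext i j
  fin_cases i <;> fin_cases j <;> rfl

theorem Kcd_isHermitian : Kcd.IsHermitian := by
  rw [IsHermitian, Kcd, conjTranspose_kronecker, conjTranspose_one]
  congr 1
  ext i j
  fin_cases i <;> fin_cases j <;> simp

theorem Kcd_mul_blockDiagonal_mul (X Y : Matrix (Fin 3) (Fin 3) ℂ) :
    Kcd * blockDiagonal ![X, Y] * Kcd = blockDiagonal ![Y, X] := by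
  have h : ∀ X Y : Matrix (Fin 3) (Fin 3) ℂ,
      Kcd * blockDiagonal ![X, Y] = blockDiagonal ![Y, X] * Kcd := by
    intro X Y
    ext ⟨i, s⟩ ⟨j, t⟩
    fin_cases s <;> fin_cases t <;>
      simp [Kcd, mul_apply, Fintype.sum_prod_type, blockDiagonal_apply, one_apply]
  rw [h, Matrix.mul_assoc, Kcd_mul_self, Matrix.mul_one]

end QuarkAntiquark

section Lattice

variable {T L : ℕ}

/-- The exchange of quark and antiquark on the whole lattice. -/
noncomputable def Kscd (T L : ℕ) : Matrix (SCDIndex T L) (SCDIndex T L) ℂ :=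
  (1 : Matrix (Site T L) (Site T L) ℂ) ⊗ₖ Kcd

theorem Kscd_mul_self : Kscd T L * Kscd T L = 1 := by
  rw [Kscd, ← mul_kronecker_mul, Matrix.one_mul, Kcd_mul_self, one_kronecker_one]

theorem Kscd_transpose : (Kscd T L)ᵀ = Kscd T L := by
  rw [Kscd, ← kroneckerMap_transpose, transpose_one, Kcd_transpose]

theorem Kscd_isHermitian : (Kscd T L).IsHermitian := by
  rw [IsHermitian, Kscd, conjTranspose_kronecker, conjTranspose_one, Kcd_isHermitian.eq]

theorem Kscd_mul_mul_apply (X : Matrix (SCDIndex T L) (SCDIndex T L) ℂ) (a b : SCDIndex T L) :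
    (Kscd T L * X * Kscd T L) a b
      = (Kcd * Matrix.of (fun i j => X (a.1, i) (b.1, j)) * Kcd) a.2 b.2 := by
  simp only [Kscd, mul_apply, Fintype.sum_prod_type (α₁ := Site T L), kroneckerMap_apply, one_apply,
    of_apply]
  simp [Finset.sum_mul]

theorem twist_conj (x : Site T L) (μ : Fin 4) :
    Kcd * x.twist μ * Kcd = (x.twist μ).map star := by
  have hK : Kcd.map star = Kcd := by
    have h : Kcdᵀ.map star = Kcd := Kcd_isHermitian
    rwa [Kcd_transpose] at h
  unfold Site.twist
  split_ifs
  · rw [hK, Kcd_mul_self, Matrix.one_mul]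
  · rw [Matrix.mul_one, Kcd_mul_self, Matrix.map_one _ (star_zero _) (star_one _)]

namespace GaugeField

variable (g : GaugeField T L) (q : ℤ)

theorem link_conj (x : Point) (μ : Fin 4) :
    Kcd * g.link q x μ * Kcd = (g.link q x μ).map star := by
  rw [link, Kcd_mul_blockDiagonal_mul, blockDiagonal_map _ _ (star_zero _)]
  congr 1
  funext s
  have h : ((g.z x μ ^ (-q) : Circle) : ℂ) = star ((g.z x μ ^ q : Circle) : ℂ) := by
    rw [_root_.zpow_neg, Circle.coe_inv_eq_conj]
    rfl
  fin_cases s <;> ext i j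
  · change ((g.z x μ ^ (-q) : Circle) : ℂ) * star ((g.U x μ : Matrix (Fin 3) (Fin 3) ℂ) i j)
      = star (((g.z x μ ^ q : Circle) : ℂ) * (g.U x μ : Matrix (Fin 3) (Fin 3) ℂ) i j)
    rw [h, star_mul']
  · change ((g.z x μ ^ q : Circle) : ℂ) * (g.U x μ : Matrix (Fin 3) (Fin 3) ℂ) i j
      = star (((g.z x μ ^ (-q) : Circle) : ℂ) * star ((g.U x μ : Matrix (Fin 3) (Fin 3) ℂ) i j))
    rw [h, star_mul', star_star, star_star]

/-- Charge conjugation: exchange of quark and antiquark conjugates the covariant derivative. -/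
theorem nabla_conj (μ : Fin 4) :
    Kscd T L * g.nabla q μ * Kscd T L = (g.nabla q μ).map star := by
  rw [nabla, Matrix.mul_sub, Matrix.sub_mul, Matrix.mul_one, Kscd_mul_self,
    Matrix.map_sub _ (star_sub), Matrix.map_one _ (star_zero _) (star_one _)]
  congr 1
  ext a b
  rw [Kscd_mul_mul_apply]
  simp only [of_apply, map_apply]
  split_ifs with hab
  · change (Kcd * (g.link q a.1.toPoint μ * a.1.twist μ) * Kcd) a.2 b.2 = _
    have h : Kcd * (g.link q a.1.toPoint μ * a.1.twist μ) * Kcd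
        = (Kcd * g.link q a.1.toPoint μ * Kcd) * (Kcd * a.1.twist μ * Kcd) := by
      calc _ = Kcd * g.link q a.1.toPoint μ * 1 * a.1.twist μ * Kcd := by
            rw [mul_one]; simp only [mul_assoc]
        _ = _ := by rw [← Kcd_mul_self]; simp only [mul_assoc]
    have hm : ((g.link q a.1.toPoint μ).map star) * ((a.1.twist μ).map star)
        = (g.link q a.1.toPoint μ * a.1.twist μ).map star :=
      (Matrix.map_mul (f := starRingEnd ℂ)).symm
    rw [h, link_conj, twist_conj, hm]
    rfl
  · change (Kcd * (0 : CDMatrix) * Kcd) a.2 b.2 = _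
    simp

theorem nabla_transpose (μ : Fin 4) :
    (g.nabla q μ)ᵀ = Kscd T L * (g.nabla q μ)ᴴ * Kscd T L := by
  have h := congrArg conjTranspose (nabla_conj g q μ)
  rw [conjTranspose_mul, conjTranspose_mul, Kscd_isHermitian.eq, ← Matrix.mul_assoc] at h
  rw [h]
  ext a b
  simp

theorem nabla_conjTranspose_transpose (μ : Fin 4) :
    ((g.nabla q μ)ᴴ)ᵀ = Kscd T L * g.nabla q μ * Kscd T L := by
  rw [nabla_conj]
  ext a b
  simp

end GaugeField

section FieldTensor

variable {R : Type*} [Ring R] [StarRing R]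

/-- The adjoint reverses the orientation of the four loops. -/
theorem star_cloverSum (u : Point → Fin 4 → R) (μ ν : Fin 4) (x : Point) :
    star (cloverSum u μ ν x) = cloverSum u ν μ x := by
  simp only [cloverSum, star_add, star_mul, star_star, ← mul_assoc,
    sub_right_comm x (unitVec μ) (unitVec ν), sub_add_eq_add_sub]
  abel

theorem star_fieldTensor [Algebra ℂ R] [StarModule ℂ R] (u : Point → Fin 4 → R) (μ ν : Fin 4)
    (x : Point) : star (fieldTensor u μ ν x) = fieldTensor u μ ν x := by
  rw [fieldTensor, star_smul, star_sub, star_cloverSum, star_cloverSum,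
    ← neg_sub (cloverSum u μ ν x), smul_neg, ← neg_smul]
  congr 1
  simp

end FieldTensor

/-- The colour-doublet matrices `X` with `Xᴴ = X` and `Xᵀ = -K X K`. -/
structure IsFieldTensorLike (X : CDMatrix) : Prop where
  isHermitian : X.IsHermitian
  transpose_eq : Xᵀ = -(Kcd * X * Kcd)

theorem isFieldTensorLike_blockDiagonal {G : Matrix (Fin 3) (Fin 3) ℂ} (hG : G.IsHermitian) :
    IsFieldTensorLike (blockDiagonal ![G, -G.map star]) := by
  have hG' : Gᵀ = G.map star := by
    ext i j
    exact (hG.apply j i).symm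
  have hG'' : (G.map star)ᵀ = G := hG
  constructor
  · rw [IsHermitian, blockDiagonal_conjTranspose]
    congr 1
    funext s
    fin_cases s
    · exact hG
    · change (-G.map star)ᴴ = -G.map star
      rw [conjTranspose_neg, conjTranspose, hG'']
  · rw [Kcd_mul_blockDiagonal_mul, blockDiagonal_transpose, ← blockDiagonal_neg]
    congr 1
    funext s
    fin_cases s
    · simp [hG']
    · change (-G.map star)ᵀ = -G
      rw [transpose_neg, hG'']

theorem IsFieldTensorLike.add {X Y : CDMatrix} (hX : IsFieldTensorLike X)
    (hY : IsFieldTensorLike Y) : IsFieldTensorLike (X + Y) where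
  isHermitian := hX.isHermitian.add hY.isHermitian
  transpose_eq := by
    rw [transpose_add, hX.transpose_eq, hY.transpose_eq, mul_add, add_mul, neg_add]

theorem IsFieldTensorLike.smul {X : CDMatrix} (hX : IsFieldTensorLike X) {c : ℂ}
    (hc : star c = c) : IsFieldTensorLike (c • X) where
  isHermitian := by rw [IsHermitian, conjTranspose_smul, hc, hX.isHermitian.eq]
  transpose_eq := by
    rw [transpose_smul, hX.transpose_eq, mul_smul_comm, smul_mul_assoc, smul_neg]

theorem GaugeField.isFieldTensorLike_tensorSU3 (g : GaugeField T L) (μ ν : Fin 4) (x : Point) :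
    IsFieldTensorLike (g.tensorSU3 μ ν x) :=
  isFieldTensorLike_blockDiagonal (star_fieldTensor _ μ ν x)

theorem GaugeField.isFieldTensorLike_tensorU1 (g : GaugeField T L) (μ ν : Fin 4) (x : Point) :
    IsFieldTensorLike (g.tensorU1 μ ν x) := by
  rw [GaugeField.tensorU1]
  set F := fieldTensor (fun y ρ => (g.z y ρ : ℂ)) μ ν x with hF
  have hstar : star F = F := star_fieldTensor _ μ ν x
  have h := isFieldTensorLike_blockDiagonal (G := F • (1 : Matrix (Fin 3) (Fin 3) ℂ))
    (by rw [IsHermitian, conjTranspose_smul, hstar, conjTranspose_one])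
  convert h using 4
  ext i j
  by_cases hij : i = j <;> simp [hij]

end Lattice

/-! ### The symmetries of the Dirac operator -/

section DiracSymmetry

variable {T L : ℕ}

/-- `γ₅` on the whole space. -/
noncomputable def bigGamma5 (T L : ℕ) (γ : Fin 4 → SpinMatrix) :
    Matrix (Index T L) (Index T L) ℂ :=
  (1 : Matrix (SCDIndex T L) (SCDIndex T L) ℂ) ⊗ₖ gamma5 γ

/-- `C K` on the whole space. -/
noncomputable def bigCK (T L : ℕ) (γ : Fin 4 → SpinMatrix) :
    Matrix (Index T L) (Index T L) ℂ :=
  Kscd T L ⊗ₖ chargeConj γ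

/-- The two symmetries of the Dirac operator: `γ₅`-hermiticity and charge conjugation. -/
structure IsDiracLike (γ : Fin 4 → SpinMatrix) (D : Matrix (Index T L) (Index T L) ℂ) : Prop where
  conjTranspose_eq : Dᴴ = bigGamma5 T L γ * D * bigGamma5 T L γ
  transpose_eq : Dᵀ = bigCK T L γ * D * bigCK T L γ

namespace IsDiracLike

variable {γ : Fin 4 → SpinMatrix}

theorem add {D D' : Matrix (Index T L) (Index T L) ℂ} (h : IsDiracLike γ D)
    (h' : IsDiracLike γ D') : IsDiracLike γ (D + D') where
  conjTranspose_eq := by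
    rw [conjTranspose_add, h.conjTranspose_eq, h'.conjTranspose_eq, Matrix.mul_add, Matrix.add_mul]
  transpose_eq := by
    rw [transpose_add, h.transpose_eq, h'.transpose_eq, Matrix.mul_add, Matrix.add_mul]

theorem smul {D : Matrix (Index T L) (Index T L) ℂ} (h : IsDiracLike γ D) {c : ℂ}
    (hc : star c = c) : IsDiracLike γ (c • D) where
  conjTranspose_eq := by
    rw [conjTranspose_smul, h.conjTranspose_eq, hc, Matrix.mul_smul, Matrix.smul_mul]
  transpose_eq := by
    rw [transpose_smul, h.transpose_eq, Matrix.mul_smul, Matrix.smul_mul]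

theorem sum {κ : Type*} [Fintype κ] {D : κ → Matrix (Index T L) (Index T L) ℂ}
    (h : ∀ i, IsDiracLike γ (D i)) : IsDiracLike γ (∑ i, D i) := by
  refine Finset.sum_induction D (IsDiracLike γ) (fun _ _ => add) ⟨?_, ?_⟩ fun i _ => h i
  · rw [conjTranspose_zero, Matrix.mul_zero, Matrix.zero_mul]
  · rw [transpose_zero, Matrix.mul_zero, Matrix.zero_mul]

/-- In a tensor product `X ⊗ₖ S`, a sign `ε` or `δ` in the symmetry of one factor is compensated by
the same sign in the other. -/
theorem kronecker {X : Matrix (SCDIndex T L) (SCDIndex T L) ℂ} {S : SpinMatrix} (ε δ : ℤˣ)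
    (hX : Xᴴ = ε • X) (hS : Sᴴ = ε • (gamma5 γ * S * gamma5 γ))
    (hX' : Xᵀ = δ • (Kscd T L * X * Kscd T L))
    (hS' : Sᵀ = δ • (chargeConj γ * S * chargeConj γ)) : IsDiracLike γ (X ⊗ₖ S) where
  conjTranspose_eq := by
    rw [conjTranspose_kronecker, hX, hS, bigGamma5, ← mul_kronecker_mul, ← mul_kronecker_mul,
      Matrix.one_mul, Matrix.mul_one]
    rcases Int.units_eq_one_or ε with rfl | rfl
    · simp only [one_smul]
    · ext a b
      simp
  transpose_eq := by
    rw [← kroneckerMap_transpose, hX', hS', bigCK, ← mul_kronecker_mul, ← mul_kronecker_mul]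
    rcases Int.units_eq_one_or δ with rfl | rfl
    · simp only [one_smul]
    · ext a b
      simp

end IsDiracLike

theorem bigGamma5_mul_self {γ : Fin 4 → SpinMatrix} (hγ : IsChiralBasis γ) :
    bigGamma5 T L γ * bigGamma5 T L γ = 1 := by
  rw [bigGamma5, ← mul_kronecker_mul, Matrix.one_mul, hγ.gamma5_mul_self, one_kronecker_one]

theorem bigCK_mul_self {γ : Fin 4 → SpinMatrix} (hγ : IsChiralBasis γ) :
    bigCK T L γ * bigCK T L γ = 1 := by
  rw [bigCK, ← mul_kronecker_mul, Kscd_mul_self, hγ.chargeConj_mul_self, one_kronecker_one]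

theorem bigCK_transpose {γ : Fin 4 → SpinMatrix} (hγ : IsChiralBasis γ) :
    (bigCK T L γ)ᵀ = -bigCK T L γ := by
  rw [bigCK, ← kroneckerMap_transpose, Kscd_transpose, hγ.chargeConj_transpose]
  ext a b
  simp

theorem bigCK_isHermitian {γ : Fin 4 → SpinMatrix} (hγ : IsChiralBasis γ) :
    (bigCK T L γ).IsHermitian := by
  rw [IsHermitian, bigCK, conjTranspose_kronecker, Kscd_isHermitian.eq,
    hγ.chargeConj_isHermitian.eq]

theorem bigGamma5_transpose {γ : Fin 4 → SpinMatrix} (hγ : IsChiralBasis γ) :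
    (bigGamma5 T L γ)ᵀ = bigGamma5 T L γ := by
  rw [bigGamma5, ← kroneckerMap_transpose, transpose_one, hγ.gamma5_transpose]

theorem bigGamma5_isHermitian {γ : Fin 4 → SpinMatrix} (hγ : IsChiralBasis γ) :
    (bigGamma5 T L γ).IsHermitian := by
  rw [IsHermitian, bigGamma5, conjTranspose_kronecker, conjTranspose_one,
    hγ.gamma5_isHermitian.eq]

theorem bigGamma5_mul_bigCK {γ : Fin 4 → SpinMatrix} (hγ : IsChiralBasis γ) :
    bigGamma5 T L γ * bigCK T L γ = bigCK T L γ * bigGamma5 T L γ := by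
  rw [bigGamma5, bigCK, ← mul_kronecker_mul, ← mul_kronecker_mul, hγ.gamma5_mul_chargeConj,
    Matrix.one_mul, Matrix.mul_one]

theorem siteDiagonal_conjTranspose {M : Site T L → CDMatrix} (hM : ∀ x, IsFieldTensorLike (M x)) :
    (Matrix.of fun a b : SCDIndex T L => if a.1 = b.1 then M a.1 a.2 b.2 else 0)ᴴ
      = Matrix.of fun a b : SCDIndex T L => if a.1 = b.1 then M a.1 a.2 b.2 else 0 := by
  ext ⟨x, i⟩ ⟨y, j⟩
  rw [conjTranspose_apply, of_apply, of_apply]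
  by_cases h : x = y
  · subst h
    simp only [if_true]
    exact (hM x).isHermitian.apply i j
  · simp [h, Ne.symm h]

theorem siteDiagonal_transpose {M : Site T L → CDMatrix} (hM : ∀ x, IsFieldTensorLike (M x)) :
    (Matrix.of fun a b : SCDIndex T L => if a.1 = b.1 then M a.1 a.2 b.2 else 0)ᵀ
      = -(Kscd T L * (Matrix.of fun a b : SCDIndex T L => if a.1 = b.1 then M a.1 a.2 b.2 else 0)
          * Kscd T L) := by
  ext ⟨x, i⟩ ⟨y, j⟩
  rw [transpose_apply, neg_apply, Kscd_mul_mul_apply]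
  simp only [of_apply]
  by_cases h : x = y
  · subst h
    simp only [if_true]
    exact congrFun (congrFun (hM x).transpose_eq i) j
  · simp only [h, Ne.symm h, if_false]
    change 0 = -(Kcd * (0 : CDMatrix) * Kcd) i j
    simp

namespace GaugeField

variable (g : GaugeField T L) {γ : Fin 4 → SpinMatrix} (hγ : IsChiralBasis γ) (q : ℤ)
include hγ

theorem isDiracLike_wilson (r : ℝ) : IsDiracLike γ (g.wilson γ q r) := by
  refine IsDiracLike.smul (IsDiracLike.sum fun μ => IsDiracLike.add ?_ (IsDiracLike.smul ?_ ?_)) ?_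
  · refine IsDiracLike.kronecker (-1) (-1) ?_ ?_ ?_ ?_
    · rw [conjTranspose_sub, conjTranspose_conjTranspose, Units.neg_smul, one_smul, neg_sub]
    · rw [(hγ.hermitian μ).eq, Units.neg_smul, one_smul]
      exact hγ.gamma_eq μ
    · rw [transpose_sub, nabla_transpose, nabla_conjTranspose_transpose, Units.neg_smul, one_smul,
        Matrix.mul_sub, Matrix.sub_mul, neg_sub]
    · rw [hγ.transpose_eq, Units.neg_smul, one_smul]
  · refine IsDiracLike.kronecker 1 1 ?_ ?_ ?_ ?_
    · rw [conjTranspose_mul, conjTranspose_conjTranspose, one_smul]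
    · rw [conjTranspose_one, Matrix.mul_one, hγ.gamma5_mul_self, one_smul]
    · rw [transpose_mul, nabla_transpose, nabla_conjTranspose_transpose, one_smul]
      calc _ = Kscd T L * (g.nabla q μ)ᴴ * (Kscd T L * Kscd T L) * g.nabla q μ * Kscd T L := by
            simp only [Matrix.mul_assoc]
        _ = _ := by rw [Kscd_mul_self, Matrix.mul_one]; simp only [Matrix.mul_assoc]
    · rw [transpose_one, Matrix.mul_one, hγ.chargeConj_mul_self, one_smul]
  · exact Complex.conj_ofReal r
  · simp

theorem isDiracLike_swTerm (c3 c1 : ℝ) : IsDiracLike γ (g.swTerm γ q c3 c1) := by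
  refine IsDiracLike.smul (IsDiracLike.sum fun μ => IsDiracLike.sum fun ν => ?_) (by simp)
  have hM : ∀ x, IsFieldTensorLike ((c3 : ℂ) • g.tensorSU3 μ ν x
      + ((q : ℂ) * (c1 : ℂ)) • g.tensorU1 μ ν x) := fun x =>
    ((g.isFieldTensorLike_tensorSU3 μ ν x).smul (Complex.conj_ofReal c3)).add
      ((g.isFieldTensorLike_tensorU1 μ ν x).smul (by simp))
  refine IsDiracLike.kronecker 1 (-1) ?_ ?_ ?_ ?_
  · rw [one_smul]
    exact siteDiagonal_conjTranspose fun x => hM x.toPoint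
  · rw [(hγ.sigma_isHermitian μ ν).eq, one_smul]
    exact hγ.sigma_eq μ ν
  · rw [Units.neg_smul, one_smul]
    exact siteDiagonal_transpose fun x => hM x.toPoint
  · rw [hγ.sigma_transpose, Units.neg_smul, one_smul]

theorem isDiracLike_dirac (r c3 c1 m : ℝ) : IsDiracLike γ (g.dirac γ q r c3 c1 m) := by
  refine ((IsDiracLike.smul ⟨?_, ?_⟩ (Complex.conj_ofReal m)).add
    (g.isDiracLike_wilson hγ q r)).add (g.isDiracLike_swTerm hγ q c3 c1)
  · rw [conjTranspose_one, Matrix.mul_one, bigGamma5_mul_self hγ]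
  · rw [transpose_one, Matrix.mul_one, bigCK_mul_self hγ]

omit hγ in
theorem ckd_eq (r c3 c1 m : ℝ) :
    g.ckd γ q r c3 c1 m = bigCK T L γ * g.dirac γ q r c3 c1 m := by
  rw [ckd, ← mul_kronecker_mul, Matrix.one_mul, Matrix.mul_one]
  rfl

theorem ckd_transpose (r c3 c1 m : ℝ) :
    (g.ckd γ q r c3 c1 m)ᵀ = -g.ckd γ q r c3 c1 m := by
  rw [ckd_eq, transpose_mul, (g.isDiracLike_dirac hγ q r c3 c1 m).transpose_eq,
    bigCK_transpose hγ, Matrix.mul_neg, Matrix.mul_assoc, bigCK_mul_self hγ, Matrix.mul_one]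

theorem ckd_eq_mul_hermDirac (r c3 c1 m : ℝ) :
    g.ckd γ q r c3 c1 m = bigCK T L γ * bigGamma5 T L γ * g.hermDirac γ q r c3 c1 m := by
  rw [ckd_eq, hermDirac, ← bigGamma5, Matrix.mul_assoc, ← Matrix.mul_assoc (bigGamma5 T L γ),
    bigGamma5_mul_self hγ, Matrix.one_mul]

theorem isKramers_hermDirac (r c3 c1 m : ℝ) :
    IsKramers (bigCK T L γ * bigGamma5 T L γ) (g.hermDirac γ q r c3 c1 m) := by
  have hD := g.isDiracLike_dirac hγ q r c3 c1 m
  have h5 := bigGamma5_mul_self (T := T) (L := L) hγ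
  constructor
  · rw [IsHermitian, conjTranspose_mul, (bigGamma5_isHermitian hγ).eq, (bigCK_isHermitian hγ).eq,
      bigGamma5_mul_bigCK hγ]
  · rw [transpose_mul, bigGamma5_transpose hγ, bigCK_transpose hγ, Matrix.mul_neg,
      bigGamma5_mul_bigCK hγ]
  · rw [Matrix.mul_assoc, ← Matrix.mul_assoc (bigGamma5 T L γ), bigGamma5_mul_bigCK hγ,
      Matrix.mul_assoc, h5, Matrix.mul_one, bigCK_mul_self hγ]
  · rw [IsHermitian, hermDirac, conjTranspose_mul, ← bigGamma5, (bigGamma5_isHermitian hγ).eq,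
      hD.conjTranspose_eq, Matrix.mul_assoc, h5, Matrix.mul_one]
  · rw [← ckd_eq_mul_hermDirac g hγ, ckd_eq, hermDirac, ← bigGamma5, transpose_mul,
      bigGamma5_transpose hγ, hD.transpose_eq, Matrix.mul_assoc (bigCK T L γ * _)]

end GaugeField

end DiracSymmetry

/-! ### The pfaffian of `C K γ₅` -/

section Orientation

variable {T L : ℕ}

/-- A matrix on the doublet, extended to all indices but spin. -/
noncomputable def onDoublet (T L : ℕ) (A : Matrix (Fin 2) (Fin 2) ℂ) :
    Matrix (SCDIndex T L) (SCDIndex T L) ℂ :=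
  (1 : Matrix (Site T L) (Site T L) ℂ) ⊗ₖ ((1 : Matrix (Fin 3) (Fin 3) ℂ) ⊗ₖ A)

theorem onDoublet_mul (A B : Matrix (Fin 2) (Fin 2) ℂ) :
    onDoublet T L A * onDoublet T L B = onDoublet T L (A * B) := by
  rw [onDoublet, onDoublet, ← mul_kronecker_mul, ← mul_kronecker_mul, Matrix.one_mul,
    Matrix.one_mul]
  rfl

theorem onDoublet_transpose (A : Matrix (Fin 2) (Fin 2) ℂ) :
    (onDoublet T L A)ᵀ = onDoublet T L Aᵀ := by
  rw [onDoublet, ← kroneckerMap_transpose, ← kroneckerMap_transpose, transpose_one, transpose_one]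
  rfl

theorem onDoublet_add (A B : Matrix (Fin 2) (Fin 2) ℂ) :
    onDoublet T L (A + B) = onDoublet T L A + onDoublet T L B := by
  rw [onDoublet, kronecker_add, kronecker_add]
  rfl

/-- The standard symplectic spin matrix, which pairs spin `0` with `1` and spin `2` with `3`. -/
noncomputable def spinSymplectic : SpinMatrix :=
  !![0, 1, 0, 0; -1, 0, 0, 0; 0, 0, 0, 1; 0, 0, -1, 0]

theorem spinSymplectic_transpose : spinSymplecticᵀ = -spinSymplectic := by
  ext i j
  fin_cases i <;> fin_cases j <;> simp [spinSymplectic]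

theorem spinSymplectic_mul_self : spinSymplectic * spinSymplectic = -1 := by
  ext i j
  fin_cases i <;> fin_cases j <;> simp [spinSymplectic, mul_apply, Fin.sum_univ_four]

theorem det_spinSymplectic : spinSymplectic.det = 1 := by
  simp [spinSymplectic, det_succ_row_zero, Fin.sum_univ_succ, Fin.succAbove]

/-- In the lexicographic numbering, the spins `0, 1` of an index form one pair of positions and the
spins `2, 3` the next one. -/
theorem pairEquiv_symm_numbering (s : Site T L ≃ Fin (T * L ^ 3)) (a : SCDIndex T L) (t : Fin 4) :
    (((pairEquiv _).symm (numbering s (a, t))).1 : ℕ)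
        = 2 * ((s.prodCongr finProdFinEquiv).trans finProdFinEquiv a : ℕ) + t / 2 ∧
      (((pairEquiv _).symm (numbering s (a, t))).2 : ℕ) = t % 2 := by
  have h := pairEquiv_val ((pairEquiv _).symm (numbering s (a, t)))
  rw [Equiv.apply_symm_apply] at h
  have h2 : (numbering s (a, t) : ℕ)
      = t + 4 * ((s.prodCongr finProdFinEquiv).trans finProdFinEquiv a : ℕ) := rfl
  have := ((pairEquiv _).symm (numbering s (a, t))).2.isLt
  omega

theorem pfaffian_one_kronecker_spinSymplectic (s : Site T L ≃ Fin (T * L ^ 3)) :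
    pfaffian (((1 : Matrix (SCDIndex T L) (SCDIndex T L) ℂ) ⊗ₖ spinSymplectic).reindex
      (numbering s) (numbering s)) = 1 := by
  suffices h : (1 : Matrix (SCDIndex T L) (SCDIndex T L) ℂ) ⊗ₖ spinSymplectic
      = (stdSymplectic (Fin (12 * (T * L ^ 3)))).submatrix
        (fun p => (pairEquiv _).symm (numbering s p)) fun p => (pairEquiv _).symm (numbering s p) by
    rw [← pfaffian_stdSymplectic (12 * (T * L ^ 3)), h]
    congr 1
    ext i j
    simp only [reindex_apply, submatrix_apply, Equiv.apply_symm_apply]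
  ext ⟨a, t⟩ ⟨b, u⟩
  rw [submatrix_apply]
  obtain ⟨h1, h2⟩ := pairEquiv_symm_numbering s a t
  obtain ⟨h3, h4⟩ := pairEquiv_symm_numbering s b u
  generalize (pairEquiv _).symm (numbering s (a, t)) = p at h1 h2
  generalize (pairEquiv _).symm (numbering s (b, u)) = p' at h3 h4
  obtain ⟨k, x⟩ := p
  obtain ⟨k', x'⟩ := p'
  rw [stdSymplectic, kroneckerMap_apply, kroneckerMap_apply, one_apply, one_apply]
  have hab : a = b ↔ ((s.prodCongr finProdFinEquiv).trans finProdFinEquiv a : ℕ)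
      = ((s.prodCongr finProdFinEquiv).trans finProdFinEquiv b : ℕ) := by
    rw [← Fin.ext_iff, Equiv.apply_eq_iff_eq]
  generalize ((s.prodCongr finProdFinEquiv).trans finProdFinEquiv a : ℕ) = n at *
  generalize ((s.prodCongr finProdFinEquiv).trans finProdFinEquiv b : ℕ) = n' at *
  have hx : x = ⟨t % 2, Nat.mod_lt _ two_pos⟩ := Fin.ext h2
  have hx' : x' = ⟨u % 2, Nat.mod_lt _ two_pos⟩ := Fin.ext h4
  subst hx hx'
  have hk : k = k' ↔ n = n' ∧ (t : ℕ) / 2 = u / 2 := by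
    rw [Fin.ext_iff]
    simp only at h1 h3
    omega
  simp only [hab, hk]
  by_cases hn : n = n'
  · fin_cases t <;> fin_cases u <;> simp [hn, spinSymplectic]
  · simp [hn]

theorem pfaffian_reindex_congruence (s : Site T L ≃ Fin (T * L ^ 3))
    (A B : Matrix (Index T L) (Index T L) ℂ) :
    pfaffian ((Bᵀ * A * B).reindex (numbering s) (numbering s))
      = B.det * pfaffian (A.reindex (numbering s) (numbering s)) := by
  rw [← det_reindex_self (numbering s) B, ← pfaffian_congruence]
  congr 1
  simp only [reindex_apply, transpose_submatrix, submatrix_mul_equiv]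

/-- A congruence on the doublet carries `1 ⊗ₖ spinSymplectic` to `Kscd ⊗ₖ spinSymplectic`: over `ℂ`
the exchange matrix is `Oᵀ * O` for a `2 × 2` matrix `O`, and `det O ^ 4 = 1`. -/
theorem pfaffian_Kscd_kronecker_spinSymplectic (s : Site T L ≃ Fin (T * L ^ 3)) :
    pfaffian ((Kscd T L ⊗ₖ spinSymplectic).reindex (numbering s) (numbering s)) = 1 := by
  let O : Matrix (Fin 2) (Fin 2) ℂ := !![1, 1 / 2; Complex.I, -Complex.I / 2]
  have hO : Oᵀ * O = !![0, 1; 1, 0] := by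
    ext i j
    fin_cases i <;> fin_cases j <;> simp [O, mul_apply, Fin.sum_univ_two] <;> ring_nf <;>
      norm_num [Complex.I_sq]
  have hdet : O.det ^ 4 = 1 := by
    simp only [O, det_fin_two_of]
    ring_nf
    simp
  have h : Kscd T L ⊗ₖ spinSymplectic
      = (onDoublet T L O ⊗ₖ (1 : SpinMatrix))ᵀ
        * ((1 : Matrix (SCDIndex T L) (SCDIndex T L) ℂ) ⊗ₖ spinSymplectic)
        * (onDoublet T L O ⊗ₖ (1 : SpinMatrix)) := by
    rw [← kroneckerMap_transpose, ← mul_kronecker_mul, ← mul_kronecker_mul, transpose_one,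
      Matrix.one_mul, Matrix.mul_one, Matrix.mul_one, onDoublet_transpose, onDoublet_mul, hO]
    rfl
  rw [h, pfaffian_reindex_congruence, pfaffian_one_kronecker_spinSymplectic, mul_one, onDoublet,
    det_kronecker, det_kronecker, det_kronecker, det_one, det_one, det_one]
  simp only [one_pow, mul_one, one_mul, Fintype.card_fin]
  rw [← pow_mul, ← pow_mul, mul_comm, mul_comm (Fintype.card _), mul_assoc, pow_mul, hdet, one_pow]

/-- The determinant of a spin matrix that acts on the antiquarks only. -/
theorem det_antiquark (N : SpinMatrix) (hN : N.det = 1) :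
    (onDoublet T L !![1, 0; 0, 0] ⊗ₖ (1 : SpinMatrix) + onDoublet T L !![0, 0; 0, 1] ⊗ₖ N).det
      = 1 := by
  have h : onDoublet T L !![1, 0; 0, 0] ⊗ₖ (1 : SpinMatrix) + onDoublet T L !![0, 0; 0, 1] ⊗ₖ N
      = (blockDiagonal fun a : SCDIndex T L => if a.2.2 = 0 then 1 else N).submatrix
        (Equiv.prodComm _ _) (Equiv.prodComm _ _) := by
    ext ⟨⟨x, i, d⟩, t⟩ ⟨⟨y, j, e⟩, u⟩
    by_cases hx : x = y <;> by_cases hi : i = j <;> fin_cases d <;> fin_cases e <;>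
      simp [onDoublet, blockDiagonal_apply, hx, hi]
  rw [h, det_submatrix_equiv_self, det_blockDiagonal]
  refine Finset.prod_eq_one fun a _ => ?_
  split_ifs
  · exact det_one
  · exact hN

/-- Only the determinant of an antisymmetric spin matrix `M` enters `pf (K ⊗ M)`, because a spin
rotation of the antiquarks alone maps it to the standard one. -/
theorem pfaffian_Kscd_kronecker (s : Site T L ≃ Fin (T * L ^ 3)) {M : SpinMatrix}
    (hM : Mᵀ = -M) (hdet : M.det = 1) :
    pfaffian ((Kscd T L ⊗ₖ M).reindex (numbering s) (numbering s)) = 1 := by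
  -- `N` is the inverse of `spinSymplectic`, times `M`.
  let N : SpinMatrix := -(spinSymplectic * M)
  have hN : N.det = 1 := by
    rw [det_neg, det_mul, det_spinSymplectic, hdet]
    norm_num
  have h1 : spinSymplectic * N = M := by
    rw [Matrix.mul_neg, ← Matrix.mul_assoc, spinSymplectic_mul_self, Matrix.neg_mul,
      Matrix.one_mul, neg_neg]
  have h2 : Nᵀ * spinSymplectic = M := by
    rw [← transpose_transpose (Nᵀ * spinSymplectic), transpose_mul, transpose_transpose,
      spinSymplectic_transpose, Matrix.neg_mul, h1, transpose_neg, hM, neg_neg]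
  have hK : Kscd T L = onDoublet T L !![0, 1; 1, 0] := rfl
  have h00 : (!![1, 0; 0, 0] : Matrix (Fin 2) (Fin 2) ℂ)ᵀ * !![0, 1; 1, 0] * !![1, 0; 0, 0]
      = 0 := by
    ext i j
    fin_cases i <;> fin_cases j <;> simp [mul_apply, Fin.sum_univ_two]
  have h11 : (!![0, 0; 0, 1] : Matrix (Fin 2) (Fin 2) ℂ)ᵀ * !![0, 1; 1, 0] * !![0, 0; 0, 1]
      = 0 := by
    ext i j
    fin_cases i <;> fin_cases j <;> simp [mul_apply, Fin.sum_univ_two]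
  have hsum : (!![0, 0; 0, 1] : Matrix (Fin 2) (Fin 2) ℂ)ᵀ * !![0, 1; 1, 0] * !![1, 0; 0, 0]
      + (!![1, 0; 0, 0] : Matrix (Fin 2) (Fin 2) ℂ)ᵀ * !![0, 1; 1, 0] * !![0, 0; 0, 1]
      = !![0, 1; 1, 0] := by
    ext i j
    fin_cases i <;> fin_cases j <;> simp [mul_apply, Fin.sum_univ_two]
  have hz : onDoublet T L 0 = 0 := by
    rw [onDoublet, kronecker_zero, kronecker_zero]
  have h : Kscd T L ⊗ₖ M
      = (onDoublet T L !![1, 0; 0, 0] ⊗ₖ (1 : SpinMatrix)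
          + onDoublet T L !![0, 0; 0, 1] ⊗ₖ N)ᵀ * (Kscd T L ⊗ₖ spinSymplectic)
        * (onDoublet T L !![1, 0; 0, 0] ⊗ₖ (1 : SpinMatrix)
          + onDoublet T L !![0, 0; 0, 1] ⊗ₖ N) := by
    rw [transpose_add, ← kroneckerMap_transpose, ← kroneckerMap_transpose, Matrix.add_mul,
      Matrix.mul_add, Matrix.add_mul, Matrix.add_mul]
    simp only [← mul_kronecker_mul, onDoublet_transpose, hK, onDoublet_mul, h00, h11, hz, h1, h2,
      transpose_one, Matrix.one_mul, Matrix.mul_one, zero_kronecker, zero_add, add_zero]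
    rw [← add_kronecker, ← onDoublet_add, hsum]
  rw [h, pfaffian_reindex_congruence, det_antiquark N hN, one_mul,
    pfaffian_Kscd_kronecker_spinSymplectic]

theorem pfaffian_bigCK_mul_bigGamma5 {γ : Fin 4 → SpinMatrix} (hγ : IsChiralBasis γ)
    (s : Site T L ≃ Fin (T * L ^ 3)) :
    pfaffian ((bigCK T L γ * bigGamma5 T L γ).reindex (numbering s) (numbering s)) = 1 := by
  rw [bigCK, bigGamma5, ← mul_kronecker_mul, Matrix.mul_one]
  refine pfaffian_Kscd_kronecker s ?_ hγ.det_chargeConj_mul_gamma5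
  rw [transpose_mul, hγ.gamma5_transpose, hγ.chargeConj_transpose, Matrix.mul_neg,
    hγ.gamma5_mul_chargeConj]

end Orientation

end CStar

theorem propositionA3 (T L : ℕ) (hT : 0 < T) (hL : 0 < L)
    (γ : Fin 4 → CStar.SpinMatrix) (hγ : CStar.IsChiralBasis γ)
    (g : CStar.GaugeField T L) (q : ℤ) (r c3 c1 m : ℝ)
    (s : CStar.Site T L ≃ Fin (T * L ^ 3)) :
    (g.ckd γ q r c3 c1 m).transpose = -g.ckd γ q r c3 c1 m ∧
    (∃ ev : Fin (12 * (T * L ^ 3)) → ℝ,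
      CStar.IsHalvedSpectrum (g.hermDirac γ q r c3 c1 m) ev) ∧
    ∀ ev : Fin (12 * (T * L ^ 3)) → ℝ,
      CStar.IsHalvedSpectrum (g.hermDirac γ q r c3 c1 m) ev →
      CStar.pfaffian ((g.ckd γ q r c3 c1 m).reindex (CStar.numbering s) (CStar.numbering s))
          = ((∏ n, ev n : ℝ) : ℂ) ∧
      (CStar.pfaffian
          ((g.ckd γ q r c3 c1 m).reindex (CStar.numbering s) (CStar.numbering s)) ≠ 0 →
        Real.sign (CStar.pfaffian
          ((g.ckd γ q r c3 c1 m).reindex (CStar.numbering s) (CStar.numbering s))).re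
          = (-1) ^ Nat.card {n // ev n < 0}) := by
  have hcard : Fintype.card (CStar.Index T L) = 2 * (12 * (T * L ^ 3)) := by
    rw [Fintype.card_congr (CStar.numbering s), Fintype.card_fin]
  obtain ⟨W, ev₀, hW, hJ, hQ⟩ := (g.isKramers_hermDirac hγ q r c3 c1 m).exists_frame hcard
  have hev₀ := CStar.isHalvedSpectrum_of_frame hcard hW hQ
  refine ⟨g.ckd_transpose hγ q r c3 c1 m, ⟨ev₀, hev₀⟩, fun ev hev => ?_⟩
  have hpf : CStar.pfaffian
      ((g.ckd γ q r c3 c1 m).reindex (CStar.numbering s) (CStar.numbering s))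
      = ((∏ n, ev n : ℝ) : ℂ) := by
    rw [g.ckd_eq_mul_hermDirac hγ, CStar.pfaffian_mul_of_frame _ hW hJ hQ,
      CStar.pfaffian_bigCK_mul_bigGamma5 hγ, mul_one, CStar.prod_eq_of_isHalvedSpectrum hev hev₀,
      Complex.ofReal_prod]
  refine ⟨hpf, fun hne => ?_⟩
  rw [hpf, Complex.ofReal_re]
  rw [hpf, Complex.ofReal_ne_zero] at hne
  exact CStar.sign_prod_eq_neg_one_pow hne
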